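/- Let $\mathcal X$ be a finite alphabet, let $\mathcal P(\mathcal X)$ be the set of probability distributions on $\mathcal X$, let $M_1\ge M_2\ge K\ge 1$ be integers and let $\alpha>0$. All logarithms are natural, $D(\cdot\|\cdot)\in[0,\infty]$ is the Kullback–Leibler divergence and $\log 0=-\infty$. Hypotheses. Let $T_K=\binom{M_1}{K}\binom{M_2}{K}K!$ and let $\mathcal M_1^K,\dots,\mathcal M_{T_K}^K$ be the sets of $K$ pairs $(i,j)\in[M_1]\times[M_2]$ in which no $i$ and no $j$ occurs twice. Let $\mathcal B_l^K=\{j:\exists i,\ (i,j)\in\mathcal M_l^K\}$. The generating tuples of the hypothesis $\mathrm H_l^K$ are $$\mathcal P_l^K=\big\{(P^{M_1},Q^{M_2})\in\mathcal P(\mathcal X)^{M_1+M_2}:\ P_i=Q_j \text{ iff } (i,j)\in\mathcal M_l^K\big\}.$$ Tests. Given $(P^{M_1},Q^{M_2})$, let $X_i^N$ ($i\in[M_1]$) be i.i.d. sequences of length $N$ from $P_i$ and $Y_j^n$ ($j\in[M_2]$) i.i.d. sequences of length $n$ from $Q_j$, all independent. A test $\phi$ maps the two databases to one of the hypotheses $\mathrm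 H_1^K,\dots,\mathrm H_{T_K}^K$ or to the reject decision $\mathrm H_{\mathrm r}$. For $(P^{M_1},Q^{M_2})\in\mathcal P_l^K$ let $\beta(\phi|P^{M_1},Q^{M_2})=\Pr\{\phi\notin\{\mathrm H_l^K,\mathrm H_{\mathrm r}\}\}$ (mismatch) and $\zeta(\phi|P^{M_1},Q^{M_2})=\Pr\{\phi=\mathrm H_{\mathrm r}\}$ (false reject). For $\lambda\ge 0$ put $$E^*_{\mathrm{LD}}(n,N,\lambda|P^{M_1},Q^{M_2})=-\frac1n\log\ \inf_{\phi}\ \zeta(\phi|P^{M_1},Q^{M_2})\in[0,\infty],$$ where the infimum is over all tests with $\beta(\phi|\tilde P^{M_1},\tilde Q^{M_2})\le e^{-n\lambda}$ for every $t\in[T_K]$ and every $(\tilde P^{M_1},\tilde Q^{M_2})\in\mathcal P_t^K$. Exponent. Let $$\mathrm{GJS}(P,Q,\alpha)=\alpha D\Big(P\Big\|\tfrac{\alpha P+Q}{1+\alpha}\Big)+D\Big(Q\Big\|\tfrac{\alpha P+Q}{1+\alpha}\Big),\qquad \mathrm G_t^K(\Omega^{M_1},\Psi^{M_2},\alpha)=\sum_{(i,j)\in\mathcal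 M_t^K}\mathrm{GJS}(\Omega_i,\Psi_j,\alpha),$$ $$E_l(P^{M_1},Q^{M_2},\Omega^{M_1},\Psi^{M_2},\alpha)=\sum_{i\in[M_1]}\alpha D(\Omega_i\|P_i)+\sum_{(i,j)\in\mathcal M_l^K}D(\Psi_j\|P_i)+\sum_{j\notin\mathcal B_l^K}D(\Psi_j\|Q_j),$$ $$F_l(P^{M_1},Q^{M_2},\alpha,\lambda,K)=\min_{t\ne s}\ \min_{\substack{(\Omega^{M_1},\Psi^{M_2})\in\mathcal P(\mathcal X)^{M_1+M_2}:\\ \mathrm G_t^K(\Omega^{M_1},\Psi^{M_2},\alpha)\le\lambda,\ \mathrm G_s^K(\Omega^{M_1},\Psi^{M_2},\alpha)\le\lambda}}E_l(P^{M_1},Q^{M_2},\Omega^{M_1},\Psi^{M_2},\alpha)$$ (the minimum over the empty set is $\infty$). Theorem. Let $N=N_n$ be any sequence of natural numbers with $N_n/n\to\alpha$ (for instance $N_n=\alpha n$ whenever this is an integer). Let $l\in[T_K]$ and $(P^{M_1},Q^{M_2})\in\mathcal P_l^K$. 1. If some $x\in\mathcal X$ has positive probability under all $P_i$ and all $Q_j$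 (for instance, if all of them have full support), then for every $\lambda>0$ $$\lim_{n\to\infty}E^*_{\mathrm{LD}}(n,N_n,\lambda|P^{M_1},Q^{M_2})=F_l(P^{M_1},Q^{M_2},\alpha,\lambda,K).$$ 2. Without any condition on the supports, the same limit holds for every $\lambda>0$ at which $\lambda\mapsto F_l(P^{M_1},Q^{M_2},\alpha,\lambda,K)$ is continuous (as a function into $[0,\infty]$). 3. This function has at most finitely many discontinuities in $(0,\infty)$. 4. For every $\lambda\ge 0$, $\liminf_{n\to\infty}E^*_{\mathrm{LD}}(n,N_n,\lambda|P^{M_1},Q^{M_2})\ge F_l(P^{M_1},Q^{M_2},\alpha,\lambda,K)$. -/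

import Mathlib

open Filter Topology
open scoped ENNReal BigOperators

noncomputable section

namespace SeqMatch

/-- The (discrete) measure on the finite alphabet `X` with mass function `p`. -/
def toMeasure {X : Type*} [Fintype X] (p : X → ℝ) : @MeasureTheory.Measure X ⊤ :=
  ∑ x, ENNReal.ofReal (p x) • @MeasureTheory.Measure.dirac X ⊤ x

/-- The Kullback-Leibler divergence `D(p ‖ q) ∈ [0, ∞]` of two mass functions on `X`
(natural logarithm). -/
def kl {X : Type*} [Fintype X] (p q : X → ℝ) : ℝ≥0∞ :=
  @InformationTheory.klDiv X ⊤ (toMeasure p) (toMeasure q)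

/-- The generalized Jensen-Shannon divergence
`α D(p ‖ (α p + q) / (1 + α)) + D(q ‖ (α p + q) / (1 + α))`. -/
def GJS {X : Type*} [Fintype X] (p q : X → ℝ) (α : ℝ) : ℝ≥0∞ :=
  ENNReal.ofReal α * kl p (fun x => (α * p x + q x) / (1 + α))
    + kl q (fun x => (α * p x + q x) / (1 + α))

/-- The hypotheses: sets of `K` pairs `(i, j)` that form a matching, that is, no index of
either database occurs in two pairs. -/
def Hyp (M₁ M₂ K : ℕ) : Type :=
  {m : Finset (Fin M₁ × Fin M₂) // m.card = K ∧
    (∀ a ∈ m, ∀ b ∈ m, a.1 = b.1 → a = b) ∧ (∀ a ∈ m, ∀ b ∈ m, a.2 = b.2 → a = b)}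

/-- The tuples of generating distributions of the hypothesis `l`: `P i = Q j` exactly for the
pairs `(i, j)` of the matching `l`. -/
def genDist (X : Type*) [Fintype X] {M₁ M₂ K : ℕ} (l : Hyp M₁ M₂ K) :
    Set ((Fin M₁ → stdSimplex ℝ X) × (Fin M₂ → stdSimplex ℝ X)) :=
  {PQ | ∀ i j, PQ.1 i = PQ.2 j ↔ (i, j) ∈ l.1}

/-- The score `G_t`: the sum of the GJS divergences over the pairs of the matching `t`. -/
def score {X : Type*} [Fintype X] {M₁ M₂ K : ℕ} (t : Hyp M₁ M₂ K)
    (Ω : Fin M₁ → stdSimplex ℝ X) (Ψ : Fin M₂ → stdSimplex ℝ X) (α : ℝ) : ℝ≥0∞ :=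
  ∑ a ∈ t.1, GJS (Ω a.1) (Ψ a.2) α

/-- The exponent `E_l`. For a matched index `j`, that is `(i, j) ∈ l`, the reference
distribution of `Ψ j` is `P i`. -/
def expE {X : Type*} [Fintype X] {M₁ M₂ K : ℕ} (l : Hyp M₁ M₂ K)
    (P : Fin M₁ → stdSimplex ℝ X) (Q : Fin M₂ → stdSimplex ℝ X)
    (Ω : Fin M₁ → stdSimplex ℝ X) (Ψ : Fin M₂ → stdSimplex ℝ X) (α : ℝ) : ℝ≥0∞ :=
  ∑ i, ENNReal.ofReal α * kl (Ω i) (P i)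
    + ∑ a ∈ l.1, kl (Ψ a.2) (P a.1)
    + ∑ j ∈ (Finset.univ : Finset (Fin M₂)) \ l.1.image Prod.snd, kl (Ψ j) (Q j)

/-- The exponent function `F_l`: the minimum of `E_l` over pairs of distinct hypotheses
`t ≠ s` and over tuples `(Ω, Ψ)` of distributions whose scores for `t` and `s` are both at most
`lam`. The minimum over the empty set is `∞`. -/
def expF {X : Type*} [Fintype X] {M₁ M₂ K : ℕ} (l : Hyp M₁ M₂ K)
    (P : Fin M₁ → stdSimplex ℝ X) (Q : Fin M₂ → stdSimplex ℝ X) (α lam : ℝ) : ℝ≥0∞ :=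
  ⨅ (t : Hyp M₁ M₂ K) (s : Hyp M₁ M₂ K) (_ : t ≠ s)
    (Ω : Fin M₁ → stdSimplex ℝ X) (Ψ : Fin M₂ → stdSimplex ℝ X)
    (_ : score t Ω Ψ α ≤ ENNReal.ofReal lam) (_ : score s Ω Ψ α ≤ ENNReal.ofReal lam),
    expE l P Q Ω Ψ α

/-- A test maps the two databases (`M₁` sequences of length `N` and `M₂` sequences of length
`n`) to a hypothesis or to the reject decision `none`. -/
abbrev Test (X : Type*) (M₁ M₂ K N n : ℕ) : Type _ :=
  (Fin M₁ → Fin N → X) → (Fin M₂ → Fin n → X) → Option (Hyp M₁ M₂ K)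

/-- The probability of the databases `(x, y)`: all symbols are independent, those of the
sequence `x i` have distribution `P i` and those of `y j` have distribution `Q j`. -/
def dataProb {X : Type*} [Fintype X] {M₁ M₂ N n : ℕ}
    (P : Fin M₁ → stdSimplex ℝ X) (Q : Fin M₂ → stdSimplex ℝ X)
    (x : Fin M₁ → Fin N → X) (y : Fin M₂ → Fin n → X) : ℝ :=
  (∏ i, ∏ k, P i (x i k)) * ∏ j, ∏ k, Q j (y j k)

open Classical in
/-- The mismatch probability under the hypothesis `l`: the test decides for a hypothesis other
than `l`. -/
def mismatch {X : Type*} [Fintype X] {M₁ M₂ K N n : ℕ} (φ : Test X M₁ M₂ K N n)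
    (l : Hyp M₁ M₂ K) (P : Fin M₁ → stdSimplex ℝ X) (Q : Fin M₂ → stdSimplex ℝ X) : ℝ :=
  ∑ x, ∑ y, if φ x y ≠ some l ∧ φ x y ≠ none then dataProb P Q x y else 0

open Classical in
/-- The false reject probability: the test rejects. -/
def falseReject {X : Type*} [Fintype X] {M₁ M₂ K N n : ℕ} (φ : Test X M₁ M₂ K N n)
    (P : Fin M₁ → stdSimplex ℝ X) (Q : Fin M₂ → stdSimplex ℝ X) : ℝ :=
  ∑ x, ∑ y, if φ x y = none then dataProb P Q x y else 0

/-- The universal constraint: under every hypothesis and every tuple of generating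
distributions of it, the mismatch probability is at most `exp (-n lam)`. -/
def Universal {X : Type*} [Fintype X] {M₁ M₂ K N n : ℕ} (φ : Test X M₁ M₂ K N n)
    (lam : ℝ) : Prop :=
  ∀ l : Hyp M₁ M₂ K, ∀ PQ ∈ genDist X l, mismatch φ l PQ.1 PQ.2 ≤ Real.exp (-(n * lam))

/-- The optimal false reject probability at `(P, Q)` among the tests with mismatch
exponent `lam`. (The set is nonempty for every `lam`, by the test that always rejects.) -/
def optFalseReject {X : Type*} [Fintype X] {M₁ M₂ : ℕ} (K N n : ℕ) (lam : ℝ)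
    (P : Fin M₁ → stdSimplex ℝ X) (Q : Fin M₂ → stdSimplex ℝ X) : ℝ :=
  sInf {z | ∃ φ : Test X M₁ M₂ K N n, Universal φ lam ∧ z = falseReject φ P Q}

/-- The optimal false reject exponent `-(1/n) log`, which is `∞` if the optimal false reject
probability is zero. -/
def optExponent {X : Type*} [Fintype X] {M₁ M₂ : ℕ} (K N n : ℕ) (lam : ℝ)
    (P : Fin M₁ → stdSimplex ℝ X) (Q : Fin M₂ → stdSimplex ℝ X) : EReal :=
  -(ENNReal.log (ENNReal.ofReal (optFalseReject K N n lam P Q))) / (n : EReal)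

end SeqMatch

end

/-! The score of `t` at `(Ω, Ψ)` is the least cost `∑ α D(Ω i ‖ P i) + ∑ D(Ψ j ‖ Q j)` over tuples
`(P, Q)` that agree on the matching `t` (`score_le_cost`, `exists_cost_le_score`). It is therefore
the exponent at which hypothesis `t`, up to closure, can imitate `(Ω, Ψ)`.

Achievability. Reject when two hypotheses have scores at the empirical distributions below a
threshold `lam + o(1)`. The method of types (`prob_le_of_le_cost`) makes this test universal and
bounds its false reject probability through `expF` at the parameters `N / n` and the threshold.
These tend to `α` and `lam`, and joint lower semicontinuity (`eventually_lt_expF`), a consequence of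
compactness of the simplices, gives the lower bound on the liminf.

Converse. If `t ≠ s` both have score less than `lam` at `(Ω, Ψ)`, then by a change of measure
(`exists_change_of_measure`) the universal constraint forces the mismatch probabilities for `t` and
for `s` to vanish under `(Ω, Ψ)`. No decision is right for both, so the test must reject there with
probability tending to one. Changing measure from `(Ω, Ψ)` to `(P, Q)` bounds the limsup by
`strictExpF`.

The gap. For `lam > 0`, `strictExpF` is the left limit of `expF`, so the bounds meet at continuity
points. By convexity (`strictExpF_le_expE`) they also meet when the strict constraints are feasible
at finite cost for the relevant pairs. A point mass at a common symbol ensures this; in general it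
fails only at the thresholds where some pair `t, s` first becomes feasible at finite cost, and these
are finitely many. -/

noncomputable section

namespace SeqMatch

/-! ### Divergence on a finite alphabet as a supremum of linear functions -/

/-- The contribution `a log (a / b) + b - a` of one symbol to the Kullback-Leibler divergence, in
its variational form as a supremum of linear functions of `(a, b)`. -/
def klTerm (a b : ℝ) : ℝ≥0∞ := ⨆ c : ℝ, ENNReal.ofReal (a * c + b * (1 - Real.exp c))

theorem klTerm_zero_zero : klTerm 0 0 = 0 := by simp [klTerm]

theorem klTerm_zero_right {a : ℝ} (ha : 0 < a) : klTerm a 0 = ⊤ := by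
  refine ENNReal.eq_top_of_forall_nnreal_le fun r => ?_
  refine le_trans ?_ (le_iSup _ ((r : ℝ) / a))
  rw [zero_mul, add_zero, mul_div_cancel₀ _ ha.ne']
  simp

/-- The supremum is attained at `c = log (a / b)` if `a > 0`. For `a = 0` it is only approached as
`c → -∞`. -/
theorem klTerm_of_pos {a b : ℝ} (ha : 0 ≤ a) (hb : 0 < b) :
    klTerm a b = ENNReal.ofReal (b * InformationTheory.klFun (a / b)) := by
  have hform : b * InformationTheory.klFun (a / b) = a * Real.log (a / b) + b - a := by
    rw [InformationTheory.klFun]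
    field_simp
  rw [hform]
  rcases ha.eq_or_lt with rfl | ha
  · simp only [zero_mul, zero_add, sub_zero, klTerm]
    apply le_antisymm
    · refine iSup_le fun c => ENNReal.ofReal_le_ofReal ?_
      nlinarith [Real.exp_pos c]
    · have h : Tendsto (fun c : ℝ => ENNReal.ofReal (b * (1 - Real.exp c))) atBot
          (𝓝 (ENNReal.ofReal (b * (1 - 0)))) :=
        ENNReal.tendsto_ofReal ((tendsto_const_nhds.sub Real.tendsto_exp_atBot).const_mul b)
      rw [sub_zero, mul_one] at h
      exact le_of_tendsto' h fun c =>
        le_iSup (fun c : ℝ => ENNReal.ofReal (b * (1 - Real.exp c))) c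
  · have hab : 0 < a / b := div_pos ha hb
    apply le_antisymm
    · refine iSup_le fun c => ENNReal.ofReal_le_ofReal ?_
      have h1 := Real.add_one_le_exp (c - Real.log (a / b))
      rw [Real.exp_sub, Real.exp_log hab, div_div_eq_mul_div, le_div_iff₀ ha] at h1
      nlinarith
    · refine le_trans (ENNReal.ofReal_le_ofReal (le_of_eq ?_)) 
        (le_iSup (fun c : ℝ => ENNReal.ofReal (a * c + b * (1 - Real.exp c))) (Real.log (a / b)))
      rw [Real.exp_log hab]
      field_simp
      ring

theorem lintegral_toMeasure {X : Type*} [Fintype X] (q : X → ℝ) (f : X → ℝ≥0∞) :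
    @MeasureTheory.lintegral X ⊤ (toMeasure q) f = ∑ x, ENNReal.ofReal (q x) * f x := by
  let _ : MeasurableSpace X := ⊤
  rw [toMeasure, MeasureTheory.lintegral_finsetSum_measure]
  refine Finset.sum_congr rfl fun x _ => ?_
  rw [MeasureTheory.lintegral_smul_measure, MeasureTheory.lintegral_dirac' x measurable_from_top,
    smul_eq_mul]

theorem toMeasure_apply {X : Type*} [Fintype X] (q : X → ℝ) (s : Set X) :
    (toMeasure q) s = ∑ x, ENNReal.ofReal (q x) * s.indicator 1 x := by
  let _ : MeasurableSpace X := ⊤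
  rw [← lintegral_toMeasure, MeasureTheory.lintegral_indicator_one (MeasurableSpace.measurableSet_top)]

theorem toMeasure_eq_zero_iff {X : Type*} [Fintype X] (q : X → ℝ) (s : Set X) :
    (toMeasure q) s = 0 ↔ ∀ x ∈ s, q x ≤ 0 := by
  rw [toMeasure_apply, Finset.sum_eq_zero_iff]
  refine forall_congr' fun x => ?_
  by_cases hx : x ∈ s <;> simp [hx]

/-- Total masses need not be one: the terms `b - a` are exactly the mass correction built into
`klDiv`. In the absolutely continuous case the density is `p / q`; otherwise a symbol with `q x = 0
< p x` makes both sides infinite. -/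
theorem kl_eq_sum_klTerm {X : Type*} [Fintype X] {p q : X → ℝ} (hp : ∀ x, 0 ≤ p x)
    (hq : ∀ x, 0 ≤ q x) : kl p q = ∑ x, klTerm (p x) (q x) := by
  let _ : MeasurableSpace X := ⊤
  have hfin : ∀ r : X → ℝ, MeasureTheory.IsFiniteMeasure (toMeasure r) := fun r => by
    refine ⟨?_⟩
    rw [toMeasure_apply, ENNReal.sum_lt_top]
    intro x _
    simp
  have := hfin p
  have := hfin q
  have hac : (toMeasure p).AbsolutelyContinuous (toMeasure q) ↔ ∀ x, q x = 0 → p x = 0 := by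
    constructor
    · intro h x hx
      have := @h {x} ((toMeasure_eq_zero_iff q {x}).2 (by simp [hx]))
      rw [toMeasure_eq_zero_iff] at this
      exact le_antisymm (this x rfl) (hp x)
    · intro h s hs
      rw [toMeasure_eq_zero_iff] at hs ⊢
      intro x hx
      exact (h x (le_antisymm (hs x hx) (hq x))).le
  rw [kl, InformationTheory.klDiv_eq_lintegral_klFun]
  split_ifs with h
  · rw [hac] at h
    have hd : (toMeasure p) = (toMeasure q).withDensity (fun x => ENNReal.ofReal (p x / q x)) := by
      ext s hs
      rw [MeasureTheory.withDensity_apply _ hs, ← MeasureTheory.lintegral_indicator hs,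
        lintegral_toMeasure, toMeasure_apply]
      refine Finset.sum_congr rfl fun x _ => ?_
      by_cases hx : x ∈ s
      · simp only [hx, Set.indicator_of_mem, Pi.one_apply, mul_one]
        rw [← ENNReal.ofReal_mul (hq x)]
        by_cases h0 : q x = 0
        · simp [h0, h x h0]
        · rw [mul_div_cancel₀ _ h0]
      · simp [hx]
    have hr : (toMeasure p).rnDeriv (toMeasure q)
        =ᵐ[toMeasure q] fun x => ENNReal.ofReal (p x / q x) := by
      conv_lhs => rw [hd]
      exact MeasureTheory.Measure.rnDeriv_withDensity _ measurable_from_top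
    rw [MeasureTheory.lintegral_congr_ae
      (g := fun x => ENNReal.ofReal (InformationTheory.klFun (p x / q x))) ?_, lintegral_toMeasure]
    · refine Finset.sum_congr rfl fun x _ => ?_
      rcases (hq x).eq_or_lt with h0 | h0
      · rw [← h0, h x h0.symm, klTerm_zero_zero]
        simp
      · rw [klTerm_of_pos (hp x) h0, ENNReal.ofReal_mul (hq x)]
    · filter_upwards [hr] with x hx
      rw [hx, ENNReal.toReal_ofReal (div_nonneg (hp x) (hq x))]
  · rw [hac] at h
    push Not at h
    obtain ⟨x, hx, hx'⟩ := h
    symm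
    rw [ENNReal.sum_eq_top]
    refine ⟨x, Finset.mem_univ x, ?_⟩
    rw [hx, klTerm_zero_right (lt_of_le_of_ne (hp x) (Ne.symm hx'))]

/-- `∑ p log (p / q)`, the Kullback-Leibler divergence as a real number. -/
def klReal {X : Type*} [Fintype X] (p q : X → ℝ) : ℝ := ∑ x, p x * Real.log (p x / q x)

/-- The corrections `q x - p x` cancel in the sum because both masses are one. -/
theorem kl_of_ac {X : Type*} [Fintype X] (p q : stdSimplex ℝ X) (h : ∀ x, q x = 0 → p x = 0) :
    kl p q = ENNReal.ofReal (klReal p q) ∧ 0 ≤ klReal p q := by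
  have hp := stdSimplex.zero_le p
  have hq := stdSimplex.zero_le q
  have hs : klReal p q = ∑ x, q x * InformationTheory.klFun (p x / q x) := by
    have : ∀ x, q x * InformationTheory.klFun (p x / q x)
        = p x * Real.log (p x / q x) + (q x - p x) := by
      intro x
      by_cases h0 : q x = 0
      · simp [h0, h x h0]
      · rw [InformationTheory.klFun]
        field_simp
        ring
    simp_rw [this]
    rw [Finset.sum_add_distrib, Finset.sum_sub_distrib, stdSimplex.sum_eq_one,
      stdSimplex.sum_eq_one, sub_self, add_zero, klReal]
  have hnn : ∀ x, 0 ≤ q x * InformationTheory.klFun (p x / q x) := fun x =>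
    mul_nonneg (hq x) (InformationTheory.klFun_nonneg (div_nonneg (hp x) (hq x)))
  refine ⟨?_, hs ▸ Finset.sum_nonneg fun x _ => hnn x⟩
  rw [kl_eq_sum_klTerm hp hq, hs, ENNReal.ofReal_sum_of_nonneg fun x _ => hnn x]
  refine Finset.sum_congr rfl fun x _ => ?_
  rcases (hq x).eq_or_lt with h0 | h0
  · rw [← h0, h x h0.symm, klTerm_zero_zero]
    simp
  · rw [klTerm_of_pos (hp x) h0]

theorem kl_ne_top_iff {X : Type*} [Fintype X] (p q : stdSimplex ℝ X) :
    kl p q ≠ ⊤ ↔ ∀ x, q x = 0 → p x = 0 := by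
  constructor
  · intro h x hx
    by_contra h0
    apply h
    rw [kl_eq_sum_klTerm (stdSimplex.zero_le p) (stdSimplex.zero_le q), ENNReal.sum_eq_top]
    refine ⟨x, Finset.mem_univ x, ?_⟩
    rw [hx, klTerm_zero_right (lt_of_le_of_ne (stdSimplex.zero_le p x) (Ne.symm h0))]
  · intro h
    rw [(kl_of_ac p q h).1]
    exact ENNReal.ofReal_ne_top

theorem kl_self {X : Type*} [Fintype X] (p : stdSimplex ℝ X) : kl p p = 0 := by
  rw [(kl_of_ac p p fun _ h => h).1, klReal, Finset.sum_eq_zero, ENNReal.ofReal_zero]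
  intro x _
  by_cases h : p x = 0
  · simp [h]
  · simp [div_self h]

/-! ### Lower semicontinuity -/

/-- Moving the weight inside the supremum leaves functions jointly continuous in the weight and both
arguments, so semicontinuity in `α` comes along. The truncation `max a 0` matches `ENNReal.ofReal
a`. -/
theorem ofReal_mul_kl_eq {X : Type*} [Fintype X] (a : ℝ) {p q : X → ℝ} (hp : ∀ x, 0 ≤ p x)
    (hq : ∀ x, 0 ≤ q x) : ENNReal.ofReal a * kl p q
      = ∑ x, ⨆ c : ℝ, ENNReal.ofReal (max a 0 * (p x * c + q x * (1 - Real.exp c))) := by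
  rw [kl_eq_sum_klTerm hp hq, Finset.mul_sum]
  refine Finset.sum_congr rfl fun x _ => ?_
  rw [klTerm, ENNReal.mul_iSup]
  refine iSup_congr fun c => ?_
  rw [ENNReal.ofReal_mul (le_max_right a 0), ENNReal.ofReal_max, ENNReal.ofReal_zero,
    max_eq_left (zero_le (a := ENNReal.ofReal a))]

theorem lowerSemicontinuous_weighted_kl (X : Type*) [Fintype X] :
    LowerSemicontinuous fun z : ℝ × (X → ℝ) × (X → ℝ) =>
      ∑ x, ⨆ c : ℝ, ENNReal.ofReal (max z.1 0 * (z.2.1 x * c + z.2.2 x * (1 - Real.exp c))) := by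
  refine lowerSemicontinuous_sum fun x _ => lowerSemicontinuous_iSup fun c => ?_
  exact (ENNReal.continuous_ofReal.comp (by fun_prop)).lowerSemicontinuous

/-- Nonnegativity is asked only near `z₀`, because the mixture in `GJS` is guaranteed nonnegative
only for positive weights. -/
theorem lowerSemicontinuousAt_ofReal_mul_kl {X Z : Type*} [Fintype X] [TopologicalSpace Z]
    {a : Z → ℝ} {p q : Z → X → ℝ} {z₀ : Z} (ha : ContinuousAt a z₀) (hp : ContinuousAt p z₀)
    (hq : ContinuousAt q z₀) (hp0 : ∀ᶠ z in 𝓝 z₀, ∀ x, 0 ≤ p z x)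
    (hq0 : ∀ᶠ z in 𝓝 z₀, ∀ x, 0 ≤ q z x) :
    LowerSemicontinuousAt (fun z => ENNReal.ofReal (a z) * kl (p z) (q z)) z₀ := by
  intro y hy
  have hlsc := lowerSemicontinuous_weighted_kl X (a z₀, p z₀, q z₀) y
  beta_reduce at hy
  rw [ofReal_mul_kl_eq _ hp0.self_of_nhds hq0.self_of_nhds] at hy
  have hc : ContinuousAt (fun z => (a z, p z, q z)) z₀ := ha.prodMk (hp.prodMk hq)
  filter_upwards [hc.eventually (hlsc hy), hp0, hq0] with z hz hpz hqz
  rw [ofReal_mul_kl_eq _ hpz hqz]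
  exact hz

theorem lowerSemicontinuousAt_kl {X Z : Type*} [Fintype X] [TopologicalSpace Z]
    {p q : Z → X → ℝ} {z₀ : Z} (hp : ContinuousAt p z₀)
    (hq : ContinuousAt q z₀) (hp0 : ∀ᶠ z in 𝓝 z₀, ∀ x, 0 ≤ p z x)
    (hq0 : ∀ᶠ z in 𝓝 z₀, ∀ x, 0 ≤ q z x) :
    LowerSemicontinuousAt (fun z => kl (p z) (q z)) z₀ := by
  simpa using lowerSemicontinuousAt_ofReal_mul_kl (a := fun _ => (1 : ℝ)) continuousAt_const hp hq
    hp0 hq0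

theorem continuous_coe_stdSimplex (X : Type*) [Fintype X] :
    Continuous fun p : stdSimplex ℝ X => (p : X → ℝ) := continuous_subtype_val

section

variable {X : Type*} [Fintype X] {M₁ M₂ K : ℕ}

/-- The divergence cost `∑ α D(Ω i ‖ P i) + ∑ D(Ψ j ‖ Q j)` of the tuple `(Ω, Ψ)` with respect to
the generating tuple `(P, Q)`. -/
def cost (α : ℝ) (P : Fin M₁ → stdSimplex ℝ X) (Q : Fin M₂ → stdSimplex ℝ X)
    (Ω : Fin M₁ → stdSimplex ℝ X) (Ψ : Fin M₂ → stdSimplex ℝ X) : ℝ≥0∞ :=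
  ∑ i, ENNReal.ofReal α * kl (Ω i) (P i) + ∑ j, kl (Ψ j) (Q j)

theorem lowerSemicontinuousAt_cost (P : Fin M₁ → stdSimplex ℝ X) (Q : Fin M₂ → stdSimplex ℝ X)
    (z₀ : ℝ × (Fin M₁ → stdSimplex ℝ X) × (Fin M₂ → stdSimplex ℝ X)) :
    LowerSemicontinuousAt (fun z : ℝ × (Fin M₁ → stdSimplex ℝ X) × (Fin M₂ → stdSimplex ℝ X) =>
      cost z.1 P Q z.2.1 z.2.2) z₀ := by
  have hc := continuous_coe_stdSimplex X
  refine LowerSemicontinuousAt.add (lowerSemicontinuousAt_sum fun i _ => ?_)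
    (lowerSemicontinuousAt_sum fun j _ => ?_)
  · exact lowerSemicontinuousAt_ofReal_mul_kl (by fun_prop)
      (hc.comp (by fun_prop : Continuous fun z : ℝ × (Fin M₁ → stdSimplex ℝ X) ×
        (Fin M₂ → stdSimplex ℝ X) => z.2.1 i)).continuousAt continuousAt_const
      (Eventually.of_forall fun z => stdSimplex.zero_le _)
      (Eventually.of_forall fun z => stdSimplex.zero_le _)
  · exact lowerSemicontinuousAt_kl
      (hc.comp (by fun_prop : Continuous fun z : ℝ × (Fin M₁ → stdSimplex ℝ X) ×
        (Fin M₂ → stdSimplex ℝ X) => z.2.2 j)).continuousAt continuousAt_const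
      (Eventually.of_forall fun z => stdSimplex.zero_le _)
      (Eventually.of_forall fun z => stdSimplex.zero_le _)

theorem mixture_nonneg {α : ℝ} (hα : 0 < α) (p q : stdSimplex ℝ X) (x : X) :
    0 ≤ (α * p x + q x) / (1 + α) := by
  have := stdSimplex.zero_le p x
  have := stdSimplex.zero_le q x
  positivity

theorem lowerSemicontinuousAt_score (t : Hyp M₁ M₂ K)
    (z₀ : ℝ × (Fin M₁ → stdSimplex ℝ X) × (Fin M₂ → stdSimplex ℝ X)) (h0 : 0 < z₀.1) :
    LowerSemicontinuousAt (fun z : ℝ × (Fin M₁ → stdSimplex ℝ X) × (Fin M₂ → stdSimplex ℝ X) =>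
      score t z.2.1 z.2.2 z.1) z₀ := by
  have hc := continuous_coe_stdSimplex X
  refine lowerSemicontinuousAt_sum fun a _ => ?_
  have hΩ : ContinuousAt (fun z : ℝ × (Fin M₁ → stdSimplex ℝ X) × (Fin M₂ → stdSimplex ℝ X) =>
      (z.2.1 a.1 : X → ℝ)) z₀ := (hc.comp (by fun_prop)).continuousAt
  have hΨ : ContinuousAt (fun z : ℝ × (Fin M₁ → stdSimplex ℝ X) × (Fin M₂ → stdSimplex ℝ X) =>
      (z.2.2 a.2 : X → ℝ)) z₀ := (hc.comp (by fun_prop)).continuousAt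
  have hpos : ∀ᶠ z : ℝ × (Fin M₁ → stdSimplex ℝ X) × (Fin M₂ → stdSimplex ℝ X) in 𝓝 z₀, 0 < z.1 :=
    continuousAt_fst.eventually (lt_mem_nhds h0)
  have hm : ContinuousAt (fun z : ℝ × (Fin M₁ → stdSimplex ℝ X) × (Fin M₂ → stdSimplex ℝ X) =>
      fun x => (z.1 * z.2.1 a.1 x + z.2.2 a.2 x) / (1 + z.1)) z₀ := by
    rw [continuousAt_pi] at hΩ hΨ ⊢
    intro x
    refine ContinuousAt.div ((continuousAt_fst.mul (hΩ x)).add (hΨ x)) (by fun_prop) ?_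
    positivity
  refine LowerSemicontinuousAt.add ?_ ?_
  · exact lowerSemicontinuousAt_ofReal_mul_kl continuousAt_fst hΩ hm
      (Eventually.of_forall fun z => stdSimplex.zero_le _)
      (hpos.mono fun z hz => mixture_nonneg hz _ _)
  · exact lowerSemicontinuousAt_kl hΨ hm
      (Eventually.of_forall fun z => stdSimplex.zero_le _)
      (hpos.mono fun z hz => mixture_nonneg hz _ _)

/-! ### Joint convexity of divergence, score and cost -/

/-- The convex combination `(1 - ε) p + ε q`. -/
def combo (ε : unitInterval) (p q : stdSimplex ℝ X) : stdSimplex ℝ X :=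
  ⟨fun x => (1 - ε) * p x + ε * q x, by
    have := (convex_stdSimplex ℝ X) p.2 q.2 (sub_nonneg.2 ε.2.2) ε.2.1 (sub_add_cancel 1 (ε : ℝ))
    exact this⟩

theorem combo_apply (ε : unitInterval) (p q : stdSimplex ℝ X) (x : X) :
    combo ε p q x = (1 - ε) * p x + ε * q x := rfl

/-- A supremum of linear functions is convex. -/
theorem klTerm_combo (ε : unitInterval) (a b a' b' : ℝ) :
    klTerm ((1 - ε) * a + ε * a') ((1 - ε) * b + ε * b')
      ≤ ENNReal.ofReal (1 - ε) * klTerm a b + ENNReal.ofReal ε * klTerm a' b' := by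
  refine iSup_le fun c => ?_
  have h : ((1 - ε) * a + ε * a') * c + ((1 - ε) * b + ε * b') * (1 - Real.exp c)
      = (1 - ε) * (a * c + b * (1 - Real.exp c)) + ε * (a' * c + b' * (1 - Real.exp c)) := by ring
  rw [h]
  refine ENNReal.ofReal_add_le.trans (add_le_add ?_ ?_)
  · rw [ENNReal.ofReal_mul (sub_nonneg.2 ε.2.2)]
    gcongr
    exact le_iSup (fun c : ℝ => ENNReal.ofReal (a * c + b * (1 - Real.exp c))) c
  · rw [ENNReal.ofReal_mul ε.2.1]
    gcongr
    exact le_iSup (fun c : ℝ => ENNReal.ofReal (a' * c + b' * (1 - Real.exp c))) c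

theorem kl_combo_le (ε : unitInterval) {p q p' q' : X → ℝ} (hp : ∀ x, 0 ≤ p x)
    (hq : ∀ x, 0 ≤ q x) (hp' : ∀ x, 0 ≤ p' x) (hq' : ∀ x, 0 ≤ q' x) :
    kl (fun x => (1 - ε) * p x + ε * p' x) (fun x => (1 - ε) * q x + ε * q' x)
      ≤ ENNReal.ofReal (1 - ε) * kl p q + ENNReal.ofReal ε * kl p' q' := by
  have h1 : 0 ≤ 1 - (ε : ℝ) := sub_nonneg.2 ε.2.2
  have h2 : 0 ≤ (ε : ℝ) := ε.2.1
  rw [kl_eq_sum_klTerm (fun x => by have := hp x; have := hp' x; positivity)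
    (fun x => by have := hq x; have := hq' x; positivity), kl_eq_sum_klTerm hp hq,
    kl_eq_sum_klTerm hp' hq', Finset.mul_sum, Finset.mul_sum, ← Finset.sum_add_distrib]
  exact Finset.sum_le_sum fun x _ => klTerm_combo ε _ _ _ _

theorem GJS_combo_le {α : ℝ} (hα : 0 < α) (ε : unitInterval) (p q p' q' : stdSimplex ℝ X) :
    GJS (combo ε p p') (combo ε q q') α
      ≤ ENNReal.ofReal (1 - ε) * GJS p q α + ENNReal.ofReal ε * GJS p' q' α := by
  have hm : (fun x => (α * combo ε p p' x + combo ε q q' x) / (1 + α))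
      = fun x => (1 - ε) * ((α * p x + q x) / (1 + α)) + ε * ((α * p' x + q' x) / (1 + α)) := by
    funext x
    rw [combo_apply, combo_apply]
    ring
  rw [GJS, hm]
  have h1 := kl_combo_le ε (stdSimplex.zero_le p) (mixture_nonneg hα p q) (stdSimplex.zero_le p')
    (mixture_nonneg hα p' q')
  have h2 := kl_combo_le ε (stdSimplex.zero_le q) (mixture_nonneg hα p q) (stdSimplex.zero_le q')
    (mixture_nonneg hα p' q')
  refine (add_le_add (mul_le_mul_right h1 _) h2).trans (le_of_eq ?_)
  rw [GJS, GJS]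
  ring

theorem score_combo_le {α : ℝ} (hα : 0 < α) (ε : unitInterval) (t : Hyp M₁ M₂ K)
    (Ω Ω' : Fin M₁ → stdSimplex ℝ X) (Ψ Ψ' : Fin M₂ → stdSimplex ℝ X) :
    score t (fun i => combo ε (Ω i) (Ω' i)) (fun j => combo ε (Ψ j) (Ψ' j)) α
      ≤ ENNReal.ofReal (1 - ε) * score t Ω Ψ α + ENNReal.ofReal ε * score t Ω' Ψ' α := by
  simp only [score, Finset.mul_sum]
  rw [← Finset.sum_add_distrib]
  exact Finset.sum_le_sum fun a _ => GJS_combo_le hα ε _ _ _ _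

theorem combo_self (ε : unitInterval) (p : stdSimplex ℝ X) : combo ε p p = p := by
  refine stdSimplex.ext (funext fun x => ?_)
  rw [combo_apply]
  ring

theorem kl_combo_left_le (ε : unitInterval) (p p' q : stdSimplex ℝ X) :
    kl (combo ε p p') q ≤ ENNReal.ofReal (1 - ε) * kl p q + ENNReal.ofReal ε * kl p' q := by
  have := kl_combo_le ε (stdSimplex.zero_le p) (stdSimplex.zero_le q) (stdSimplex.zero_le p')
    (stdSimplex.zero_le q)
  conv_lhs => rw [← combo_self ε q]
  exact this

theorem cost_combo_le {α : ℝ} (ε : unitInterval)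
    (P : Fin M₁ → stdSimplex ℝ X) (Q : Fin M₂ → stdSimplex ℝ X)
    (Ω Ω' : Fin M₁ → stdSimplex ℝ X) (Ψ Ψ' : Fin M₂ → stdSimplex ℝ X) :
    cost α P Q (fun i => combo ε (Ω i) (Ω' i)) (fun j => combo ε (Ψ j) (Ψ' j))
      ≤ ENNReal.ofReal (1 - ε) * cost α P Q Ω Ψ + ENNReal.ofReal ε * cost α P Q Ω' Ψ' := by
  simp only [cost, mul_add, Finset.mul_sum]
  rw [add_add_add_comm, ← Finset.sum_add_distrib, ← Finset.sum_add_distrib]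
  refine add_le_add (Finset.sum_le_sum fun i _ => ?_)
    (Finset.sum_le_sum fun j _ => kl_combo_left_le ε _ _ _)
  refine (mul_le_mul_right (kl_combo_left_le ε _ _ _) _).trans (le_of_eq ?_)
  ring

end

/-! ### Scores as minimal costs -/

section

variable {X : Type*} [Fintype X] {M₁ M₂ K : ℕ}

theorem Hyp.injOn_fst (t : Hyp M₁ M₂ K) : Set.InjOn Prod.fst (t.1 : Set (Fin M₁ × Fin M₂)) :=
  fun a ha b hb h => t.2.2.1 a ha b hb h

theorem Hyp.injOn_snd (t : Hyp M₁ M₂ K) : Set.InjOn Prod.snd (t.1 : Set (Fin M₁ × Fin M₂)) :=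
  fun a ha b hb h => t.2.2.2 a ha b hb h

instance : Finite (Hyp M₁ M₂ K) :=
  inferInstanceAs (Finite {m : Finset (Fin M₁ × Fin M₂) // m.card = K ∧
    (∀ a ∈ m, ∀ b ∈ m, a.1 = b.1 → a = b) ∧ (∀ a ∈ m, ∀ b ∈ m, a.2 = b.2 → a = b)})

theorem expE_eq_cost (l : Hyp M₁ M₂ K) {P : Fin M₁ → stdSimplex ℝ X} {Q : Fin M₂ → stdSimplex ℝ X}
    (hPQ : ∀ a ∈ l.1, P a.1 = Q a.2) (Ω : Fin M₁ → stdSimplex ℝ X) (Ψ : Fin M₂ → stdSimplex ℝ X)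
    (α : ℝ) : expE l P Q Ω Ψ α = cost α P Q Ω Ψ := by
  rw [expE, cost, add_assoc]
  congr 1
  rw [Finset.sum_congr rfl fun a ha => by rw [hPQ a ha],
    ← Finset.sum_image (f := fun j => kl (Ψ j) (Q j)) l.injOn_snd, add_comm,
    Finset.sum_sdiff (Finset.subset_univ _)]

/-- The mixture `(α p + q) / (1 + α)`. -/
def mixture {α : ℝ} (hα : 0 < α) (p q : stdSimplex ℝ X) : stdSimplex ℝ X :=
  ⟨fun x => (α * p x + q x) / (1 + α), mixture_nonneg hα p q, by
    rw [← Finset.sum_div, Finset.sum_add_distrib, ← Finset.mul_sum, stdSimplex.sum_eq_one,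
      stdSimplex.sum_eq_one]
    field_simp
    ring⟩

theorem mixture_apply {α : ℝ} (hα : 0 < α) (p q : stdSimplex ℝ X) (x : X) :
    mixture hα p q x = (α * p x + q x) / (1 + α) := rfl

theorem GJS_eq {α : ℝ} (hα : 0 < α) (p q : stdSimplex ℝ X) :
    GJS p q α = ENNReal.ofReal α * kl p (mixture hα p q) + kl q (mixture hα p q) := rfl

theorem GJS_self {α : ℝ} (hα : 0 < α) (p : stdSimplex ℝ X) : GJS p p α = 0 := by
  have : mixture hα p p = p := by
    refine stdSimplex.ext (funext fun x => ?_)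
    rw [mixture_apply]
    field_simp
    ring
  rw [GJS_eq hα, this, kl_self, mul_zero, add_zero]

theorem mixture_eq_zero_iff {α : ℝ} (hα : 0 < α) (p q : stdSimplex ℝ X) (x : X) :
    mixture hα p q x = 0 ↔ p x = 0 ∧ q x = 0 := by
  have hp := stdSimplex.zero_le p x
  have hq := stdSimplex.zero_le q x
  rw [mixture_apply, div_eq_zero_iff, or_iff_left (by positivity),
    add_eq_zero_iff_of_nonneg (by positivity) hq, mul_eq_zero, or_iff_right hα.ne']

/-- The generalized Jensen-Shannon divergence is the least cost of explaining both arguments by one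
distribution. -/
theorem GJS_le {α : ℝ} (hα : 0 < α) (p q r : stdSimplex ℝ X) :
    GJS p q α ≤ ENNReal.ofReal α * kl p r + kl q r := by
  by_cases hp : kl p r = ⊤
  · rw [hp, ENNReal.mul_top (by simpa using hα), top_add]
    exact le_top
  by_cases hq : kl q r = ⊤
  · rw [hq, add_top]
    exact le_top
  have hp' := (kl_ne_top_iff p r).1 hp
  have hq' := (kl_ne_top_iff q r).1 hq
  set m := mixture hα p q with hm
  have hpm : ∀ x, m x = 0 → p x = 0 := fun x h => ((mixture_eq_zero_iff hα p q x).1 h).1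
  have hqm : ∀ x, m x = 0 → q x = 0 := fun x h => ((mixture_eq_zero_iff hα p q x).1 h).2
  have hmr : ∀ x, r x = 0 → m x = 0 := fun x h =>
    (mixture_eq_zero_iff hα p q x).2 ⟨hp' x h, hq' x h⟩
  obtain ⟨h1, h1'⟩ := kl_of_ac p m hpm
  obtain ⟨h2, h2'⟩ := kl_of_ac q m hqm
  obtain ⟨h3, h3'⟩ := kl_of_ac p r hp'
  obtain ⟨h4, h4'⟩ := kl_of_ac q r hq'
  obtain ⟨-, h5⟩ := kl_of_ac m r hmr
  rw [GJS_eq hα, ← hm, h1, h2, h3, h4, ← ENNReal.ofReal_mul hα.le, ← ENNReal.ofReal_mul hα.le,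
    ← ENNReal.ofReal_add (by positivity) h2', ← ENNReal.ofReal_add (by positivity) h4']
  apply ENNReal.ofReal_le_ofReal
  have key : ∀ s : stdSimplex ℝ X, (∀ x, m x = 0 → s x = 0) → (∀ x, r x = 0 → s x = 0) →
      klReal s r - klReal s m = ∑ x, s x * Real.log (m x / r x) := by
    intro s hsm hsr
    rw [klReal, klReal, ← Finset.sum_sub_distrib]
    refine Finset.sum_congr rfl fun x _ => ?_
    by_cases hs : s x = 0
    · simp [hs]
    have hmx : m x ≠ 0 := fun h => hs (hsm x h)
    have hrx : r x ≠ 0 := fun h => hs (hsr x h)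
    rw [Real.log_div hs hrx, Real.log_div hs hmx, Real.log_div hmx hrx]
    ring
  -- The compensation identity: explaining `p` and `q` by `r` instead of their mixture `m` costs
  -- exactly `(1 + α) D(m ‖ r)` more.
  have hk : α * (klReal p r - klReal p m) + (klReal q r - klReal q m)
      = (1 + α) * klReal m r := by
    rw [key p hpm hp', key q hqm hq', klReal, Finset.mul_sum, Finset.mul_sum,
      ← Finset.sum_add_distrib]
    refine Finset.sum_congr rfl fun x _ => ?_
    have : (1 + α) * m x = α * p x + q x := by
      rw [hm, mixture_apply]
      field_simp
    rw [← mul_assoc (1 + α), this]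
    ring
  nlinarith [mul_nonneg (by positivity : 0 ≤ 1 + α) h5]

/-- Each matched pair is handled by `GJS_le`. The pairs of a matching use disjoint indices, so their
terms form part of the cost and the remaining ones can be dropped. -/
theorem score_le_cost {α : ℝ} (hα : 0 < α) (t : Hyp M₁ M₂ K) {P : Fin M₁ → stdSimplex ℝ X}
    {Q : Fin M₂ → stdSimplex ℝ X} (hPQ : ∀ a ∈ t.1, P a.1 = Q a.2)
    (Ω : Fin M₁ → stdSimplex ℝ X) (Ψ : Fin M₂ → stdSimplex ℝ X) :
    score t Ω Ψ α ≤ cost α P Q Ω Ψ := by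
  calc score t Ω Ψ α
      ≤ ∑ a ∈ t.1, (ENNReal.ofReal α * kl (Ω a.1) (P a.1) + kl (Ψ a.2) (Q a.2)) := by
        refine Finset.sum_le_sum fun a ha => ?_
        rw [hPQ a ha]
        exact GJS_le hα _ _ _
    _ = ∑ i ∈ t.1.image Prod.fst, ENNReal.ofReal α * kl (Ω i) (P i)
        + ∑ j ∈ t.1.image Prod.snd, kl (Ψ j) (Q j) := by
        rw [Finset.sum_add_distrib,
          Finset.sum_image (f := fun i => ENNReal.ofReal α * kl (Ω i) (P i)) t.injOn_fst,
          Finset.sum_image (f := fun j => kl (Ψ j) (Q j)) t.injOn_snd]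
    _ ≤ cost α P Q Ω Ψ := add_le_add (Finset.sum_le_sum_of_subset (Finset.subset_univ _))
        (Finset.sum_le_sum_of_subset (Finset.subset_univ _))

/-- Both members of a matched pair receive the mixture, and unmatched indices keep their own
distribution at no cost. The tuple may have further coincidences, so it need not lie in `genDist X
t`; `Universal.mismatch_le` covers this case. -/
theorem exists_cost_le_score {α : ℝ} (hα : 0 < α) (t : Hyp M₁ M₂ K)
    (Ω : Fin M₁ → stdSimplex ℝ X) (Ψ : Fin M₂ → stdSimplex ℝ X) :
    ∃ (P : Fin M₁ → stdSimplex ℝ X) (Q : Fin M₂ → stdSimplex ℝ X),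
      (∀ a ∈ t.1, P a.1 = Q a.2) ∧ cost α P Q Ω Ψ ≤ score t Ω Ψ α := by
  classical
  set P : Fin M₁ → stdSimplex ℝ X := fun i =>
    if h : ∃ j, (i, j) ∈ t.1 then mixture hα (Ω i) (Ψ h.choose) else Ω i with hP
  set Q : Fin M₂ → stdSimplex ℝ X := fun j =>
    if h : ∃ i, (i, j) ∈ t.1 then mixture hα (Ω h.choose) (Ψ j) else Ψ j with hQ
  have hP1 : ∀ a ∈ t.1, P a.1 = mixture hα (Ω a.1) (Ψ a.2) := by
    intro a ha
    have h : ∃ j, (a.1, j) ∈ t.1 := ⟨a.2, ha⟩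
    have h2 := congrArg Prod.snd (t.injOn_fst h.choose_spec ha rfl)
    simp only [hP]
    rw [dif_pos h]
    dsimp only at h2
    rw [h2]
  have hQ1 : ∀ a ∈ t.1, Q a.2 = mixture hα (Ω a.1) (Ψ a.2) := by
    intro a ha
    have h : ∃ i, (i, a.2) ∈ t.1 := ⟨a.1, ha⟩
    have h2 := congrArg Prod.fst (t.injOn_snd h.choose_spec ha rfl)
    simp only [hQ]
    rw [dif_pos h]
    dsimp only at h2
    rw [h2]
  have hP2 : ∀ i ∉ t.1.image Prod.fst, kl (Ω i) (P i) = 0 := by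
    intro i hi
    have : ¬ ∃ j, (i, j) ∈ t.1 := fun ⟨j, hj⟩ => hi (Finset.mem_image.2 ⟨(i, j), hj, rfl⟩)
    simp only [hP]
    rw [dif_neg this, kl_self]
  have hQ2 : ∀ j ∉ t.1.image Prod.snd, kl (Ψ j) (Q j) = 0 := by
    intro j hj
    have : ¬ ∃ i, (i, j) ∈ t.1 := fun ⟨i, hi⟩ => hj (Finset.mem_image.2 ⟨(i, j), hi, rfl⟩)
    simp only [hQ]
    rw [dif_neg this, kl_self]
  refine ⟨P, Q, fun a ha => (hP1 a ha).trans (hQ1 a ha).symm, le_of_eq ?_⟩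
  rw [cost, ← Finset.sum_subset (Finset.subset_univ (t.1.image Prod.fst))
      (fun i _ hi => by rw [hP2 i hi, mul_zero]),
    ← Finset.sum_subset (Finset.subset_univ (t.1.image Prod.snd)) (fun j _ hj => hQ2 j hj),
    Finset.sum_image t.injOn_fst, Finset.sum_image t.injOn_snd, ← Finset.sum_add_distrib, score]
  refine Finset.sum_congr rfl fun a ha => ?_
  rw [hP1 a ha, hQ1 a ha, GJS_eq hα]

/-! ### Strict constraints and continuity in the threshold -/

/-- The infimum defining `expF` with strict constraints on the scores. -/
def strictExpF (l : Hyp M₁ M₂ K) (P : Fin M₁ → stdSimplex ℝ X) (Q : Fin M₂ → stdSimplex ℝ X)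
    (α lam : ℝ) : ℝ≥0∞ :=
  ⨅ (t : Hyp M₁ M₂ K) (s : Hyp M₁ M₂ K) (_ : t ≠ s)
    (Ω : Fin M₁ → stdSimplex ℝ X) (Ψ : Fin M₂ → stdSimplex ℝ X)
    (_ : score t Ω Ψ α < ENNReal.ofReal lam) (_ : score s Ω Ψ α < ENNReal.ofReal lam),
    expE l P Q Ω Ψ α

section
variable {l : Hyp M₁ M₂ K} {P : Fin M₁ → stdSimplex ℝ X} {Q : Fin M₂ → stdSimplex ℝ X} {α lam : ℝ}

theorem expF_lt_iff {c : ℝ≥0∞} : expF l P Q α lam < c ↔ ∃ t s : Hyp M₁ M₂ K, t ≠ s ∧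
    ∃ Ω Ψ, score t Ω Ψ α ≤ ENNReal.ofReal lam ∧ score s Ω Ψ α ≤ ENNReal.ofReal lam ∧
      expE l P Q Ω Ψ α < c := by
  simp only [expF, iInf_lt_iff, exists_prop]

theorem strictExpF_lt_iff {c : ℝ≥0∞} : strictExpF l P Q α lam < c ↔ ∃ t s : Hyp M₁ M₂ K, t ≠ s ∧
    ∃ Ω Ψ, score t Ω Ψ α < ENNReal.ofReal lam ∧ score s Ω Ψ α < ENNReal.ofReal lam ∧
      expE l P Q Ω Ψ α < c := by
  simp only [strictExpF, iInf_lt_iff, exists_prop]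

theorem le_expF_iff {c : ℝ≥0∞} : c ≤ expF l P Q α lam ↔ ∀ t s : Hyp M₁ M₂ K, t ≠ s →
    ∀ Ω Ψ, score t Ω Ψ α ≤ ENNReal.ofReal lam → score s Ω Ψ α ≤ ENNReal.ofReal lam →
      c ≤ expE l P Q Ω Ψ α := by
  simp only [expF, le_iInf_iff]

theorem expF_antitone : Antitone fun lam => expF l P Q α lam := by
  intro r r' h
  refine le_expF_iff.2 fun t s hts Ω Ψ ht hs => ?_
  have h' := ENNReal.ofReal_le_ofReal h
  exact le_expF_iff.1 le_rfl t s hts Ω Ψ (ht.trans h') (hs.trans h')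

/-- A strictly feasible point is weakly feasible at the larger of its two scores, which is below
`lam`. -/
theorem exists_lt_expF_lt {c : ℝ≥0∞} (h : strictExpF l P Q α lam < c) :
    ∃ r < lam, expF l P Q α r < c := by
  obtain ⟨t, s, hts, Ω, Ψ, ht, hs, hE⟩ := strictExpF_lt_iff.1 h
  have hmax : max (score t Ω Ψ α) (score s Ω Ψ α) < ENNReal.ofReal lam := max_lt ht hs
  have hne : max (score t Ω Ψ α) (score s Ω Ψ α) ≠ ⊤ := hmax.ne_top
  have hr : ENNReal.ofReal (max (score t Ω Ψ α) (score s Ω Ψ α)).toReal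
      = max (score t Ω Ψ α) (score s Ω Ψ α) := ENNReal.ofReal_toReal hne
  refine ⟨(max (score t Ω Ψ α) (score s Ω Ψ α)).toReal, ?_,
    expF_lt_iff.2 ⟨t, s, hts, Ω, Ψ, ?_, ?_, hE⟩⟩
  · exact (ENNReal.lt_ofReal_iff_toReal_lt hne).1 hmax
  · rw [hr]
    exact le_max_left _ _
  · rw [hr]
    exact le_max_right _ _

theorem strictExpF_le_of_lt {r : ℝ} (hlam : 0 < lam) (h : r < lam) :
    strictExpF l P Q α lam ≤ expF l P Q α r := by
  have h' : ENNReal.ofReal r < ENNReal.ofReal lam := (ENNReal.ofReal_lt_ofReal_iff hlam).2 h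
  refine le_of_forall_gt fun c hc => ?_
  obtain ⟨t, s, hts, Ω, Ψ, ht, hs, hE⟩ := expF_lt_iff.1 hc
  exact strictExpF_lt_iff.2 ⟨t, s, hts, Ω, Ψ, ht.trans_lt h', hs.trans_lt h', hE⟩

theorem strictExpF_le_of_continuousAt (hlam : 0 < lam)
    (hc : ContinuousAt (fun r => expF l P Q α r) lam) :
    strictExpF l P Q α lam ≤ expF l P Q α lam := by
  have h : Tendsto (fun r => expF l P Q α r) (𝓝[<] lam) (𝓝 (expF l P Q α lam)) :=
    hc.tendsto.mono_left nhdsWithin_le_nhds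
  refine ge_of_tendsto h ?_
  filter_upwards [self_mem_nhdsWithin] with r hr
  exact strictExpF_le_of_lt hlam hr

/-- Joint lower semicontinuity of the exponent in `α` and `lam`. -/
theorem eventually_lt_expF (hPQ : ∀ a ∈ l.1, P a.1 = Q a.2) (hα : 0 < α) {c : ℝ≥0∞}
    (h : c < expF l P Q α lam) :
    ∀ᶠ z : ℝ × ℝ in 𝓝 (α, lam), c ≤ expF l P Q z.1 z.2 := by
  have main : ∀ t s : Hyp M₁ M₂ K, t ≠ s → ∀ᶠ z : ℝ × ℝ in 𝓝 (α, lam),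
      ∀ w ∈ (Set.univ : Set ((Fin M₁ → stdSimplex ℝ X) × (Fin M₂ → stdSimplex ℝ X))),
        ENNReal.ofReal z.2 < score t w.1 w.2 z.1 ∨ ENNReal.ofReal z.2 < score s w.1 w.2 z.1 ∨
          c < cost z.1 P Q w.1 w.2 := by
    -- Each of the three strict inequalities is open by lower semicontinuity, and compactness of the
    -- space of `(Ω, Ψ)` makes the neighbourhood of `(α, lam)` uniform.
    intro t s hts
    refine isCompact_univ.eventually_forall_of_forall_eventually fun w _ => ?_
    have hφ : ContinuousAt (fun y : (ℝ × ℝ) × ((Fin M₁ → stdSimplex ℝ X) ×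
        (Fin M₂ → stdSimplex ℝ X)) => (y.1.1, y.2)) ((α, lam), w) := by fun_prop
    have hsc : ∀ u : Hyp M₁ M₂ K, ENNReal.ofReal lam < score u w.1 w.2 α →
        ∀ᶠ y : (ℝ × ℝ) × ((Fin M₁ → stdSimplex ℝ X) × (Fin M₂ → stdSimplex ℝ X)) in
          𝓝 ((α, lam), w), ENNReal.ofReal y.1.2 < score u y.2.1 y.2.2 y.1.1 := by
      intro u hu
      obtain ⟨d, hd1, hd2⟩ := exists_between hu
      have h1 := hφ.eventually (lowerSemicontinuousAt_score u (α, w) hα d hd2)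
      have h2 : ContinuousAt (fun y : (ℝ × ℝ) × ((Fin M₁ → stdSimplex ℝ X) ×
          (Fin M₂ → stdSimplex ℝ X)) => ENNReal.ofReal y.1.2) ((α, lam), w) :=
        (ENNReal.continuous_ofReal.comp (by fun_prop)).continuousAt
      filter_upwards [h1, h2.eventually (gt_mem_nhds hd1)] with y hy1 hy2
      exact lt_trans hy2 hy1
    by_cases ht : ENNReal.ofReal lam < score t w.1 w.2 α
    · exact (hsc t ht).mono fun y hy => Or.inl hy
    by_cases hs : ENNReal.ofReal lam < score s w.1 w.2 α
    · exact (hsc s hs).mono fun y hy => Or.inr (Or.inl hy)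
    have hE : c < cost α P Q w.1 w.2 := by
      rw [← expE_eq_cost l hPQ]
      exact h.trans_le (le_expF_iff.1 le_rfl t s hts w.1 w.2 (not_lt.1 ht) (not_lt.1 hs))
    exact (hφ.eventually (lowerSemicontinuousAt_cost P Q (α, w) c hE)).mono
      fun y hy => Or.inr (Or.inr hy)
  have main' : ∀ᶠ z : ℝ × ℝ in 𝓝 (α, lam), ∀ t s : Hyp M₁ M₂ K, t ≠ s →
      ∀ w ∈ (Set.univ : Set ((Fin M₁ → stdSimplex ℝ X) × (Fin M₂ → stdSimplex ℝ X))),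
        ENNReal.ofReal z.2 < score t w.1 w.2 z.1 ∨ ENNReal.ofReal z.2 < score s w.1 w.2 z.1 ∨
          c < cost z.1 P Q w.1 w.2 := by
    simp only [eventually_all]
    exact main
  filter_upwards [main'] with z hz
  refine le_expF_iff.2 fun t s hts Ω Ψ ht hs => ?_
  rw [expE_eq_cost l hPQ]
  rcases hz t s hts (Ω, Ψ) trivial with h | h | h
  · exact absurd h (not_lt.2 ht)
  · exact absurd h (not_lt.2 hs)
  · exact h.le

/-- If the strict constraints for `t` and `s` are feasible at finite cost, then every point
satisfying the weak constraints is approximated by points satisfying the strict ones. -/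
theorem strictExpF_le_expE (hPQ : ∀ a ∈ l.1, P a.1 = Q a.2) (hα : 0 < α)
    {t s : Hyp M₁ M₂ K} (hts : t ≠ s) {Ω Ω' : Fin M₁ → stdSimplex ℝ X}
    {Ψ Ψ' : Fin M₂ → stdSimplex ℝ X}
    (ht : score t Ω Ψ α ≤ ENNReal.ofReal lam) (hs : score s Ω Ψ α ≤ ENNReal.ofReal lam)
    (ht' : score t Ω' Ψ' α < ENNReal.ofReal lam) (hs' : score s Ω' Ψ' α < ENNReal.ofReal lam)
    (hE' : cost α P Q Ω' Ψ' ≠ ⊤) :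
    strictExpF l P Q α lam ≤ expE l P Q Ω Ψ α := by
  rw [expE_eq_cost l hPQ]
  have hlim : Tendsto (fun e : ℝ => cost α P Q Ω Ψ + ENNReal.ofReal e * cost α P Q Ω' Ψ')
      (𝓝[>] 0) (𝓝 (cost α P Q Ω Ψ)) := by
    have h1 : Tendsto (fun e : ℝ => ENNReal.ofReal e) (𝓝[>] 0) (𝓝 0) := by
      have := (ENNReal.continuous_ofReal.tendsto 0).mono_left
        (nhdsWithin_le_nhds (s := Set.Ioi (0 : ℝ)))
      rwa [ENNReal.ofReal_zero] at this
    have h2 := tendsto_const_nhds (x := cost α P Q Ω Ψ).add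
      (ENNReal.Tendsto.mul_const h1 (Or.inr hE'))
    rwa [zero_mul, add_zero] at h2
  -- Moving a fraction `e` towards the strictly feasible point makes the constraints strict, and
  -- since that point has finite cost the extra cost vanishes with `e`.
  refine ge_of_tendsto hlim ?_
  filter_upwards [self_mem_nhdsWithin, Ioo_mem_nhdsGT (one_pos : (0 : ℝ) < 1)] with e he0 he1
  set ε : unitInterval := ⟨e, he1.1.le, he1.2.le⟩ with hε
  have hle1 : ENNReal.ofReal (1 - (ε : ℝ)) ≤ 1 := by
    rw [← ENNReal.ofReal_one]
    exact ENNReal.ofReal_le_ofReal (by simp [hε, he1.1.le])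
  have hsc : ∀ u : Hyp M₁ M₂ K, score u Ω Ψ α ≤ ENNReal.ofReal lam →
      score u Ω' Ψ' α < ENNReal.ofReal lam →
      score u (fun i => combo ε (Ω i) (Ω' i)) (fun j => combo ε (Ψ j) (Ψ' j)) α
        < ENNReal.ofReal lam := by
    intro u hu hu'
    refine (score_combo_le hα ε u Ω Ω' Ψ Ψ').trans_lt ?_
    have hs1 : ENNReal.ofReal (1 - (ε : ℝ)) + ENNReal.ofReal ε = 1 := by
      rw [← ENNReal.ofReal_add (sub_nonneg.2 ε.2.2) ε.2.1, sub_add_cancel, ENNReal.ofReal_one]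
    calc _ < ENNReal.ofReal (1 - (ε : ℝ)) * ENNReal.ofReal lam
          + ENNReal.ofReal ε * ENNReal.ofReal lam := by
          refine ENNReal.add_lt_add_of_le_of_lt ?_ (mul_le_mul_right hu _) ?_
          · exact ENNReal.mul_ne_top ENNReal.ofReal_ne_top (hu.trans_lt ENNReal.ofReal_lt_top).ne
          · exact ENNReal.mul_lt_mul_right (by simpa [hε] using he0) ENNReal.ofReal_ne_top hu'
      _ = ENNReal.ofReal lam := by rw [← add_mul, hs1, one_mul]
  calc strictExpF l P Q α lam
      ≤ cost α P Q (fun i => combo ε (Ω i) (Ω' i)) (fun j => combo ε (Ψ j) (Ψ' j)) := by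
        refine le_of_forall_gt fun c hc => strictExpF_lt_iff.2 ⟨t, s, hts, _, _, hsc t ht ht',
          hsc s hs hs', ?_⟩
        rw [expE_eq_cost l hPQ]
        exact hc
    _ ≤ ENNReal.ofReal (1 - ε) * cost α P Q Ω Ψ + ENNReal.ofReal ε * cost α P Q Ω' Ψ' :=
        cost_combo_le ε P Q Ω Ω' Ψ Ψ'
    _ ≤ cost α P Q Ω Ψ + ENNReal.ofReal e * cost α P Q Ω' Ψ' :=
        add_le_add (mul_le_of_le_one_left' hle1) le_rfl

/-- The tuple with every entry the point mass at the common symbol has all scores zero and finite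
cost, hence is strictly feasible for every pair of hypotheses. -/
theorem strictExpF_le_of_common_support (hPQ : ∀ a ∈ l.1, P a.1 = Q a.2) (hα : 0 < α)
    (hlam : 0 < lam) (hx : ∃ x, (∀ i, 0 < P i x) ∧ (∀ j, 0 < Q j x)) :
    strictExpF l P Q α lam ≤ expF l P Q α lam := by
  classical
  obtain ⟨x, hP, hQ⟩ := hx
  set δ : stdSimplex ℝ X := stdSimplex.vertex x with hδ
  have hfin : ∀ q : stdSimplex ℝ X, 0 < q x → kl δ q ≠ ⊤ := by
    intro q hq
    rw [kl_ne_top_iff]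
    intro y hy
    have hne : y ≠ x := fun h => hq.ne' (h ▸ hy)
    rw [hδ, stdSimplex.vertex_coe, Pi.single_eq_of_ne hne]
  have hsc : ∀ u : Hyp M₁ M₂ K, score u (fun _ => δ) (fun _ => δ) α < ENNReal.ofReal lam := by
    intro u
    rw [score, Finset.sum_eq_zero fun a _ => GJS_self hα δ]
    simpa using hlam
  refine le_of_forall_gt fun c hc => ?_
  obtain ⟨t, s, hts, Ω, Ψ, ht, hs, hE⟩ := expF_lt_iff.1 hc
  refine (strictExpF_le_expE hPQ hα hts ht hs (hsc t) (hsc s) ?_).trans_lt hE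
  refine ENNReal.add_ne_top.2 ⟨?_, ?_⟩
  · exact ENNReal.sum_ne_top.2 fun i _ =>
      ENNReal.mul_ne_top ENNReal.ofReal_ne_top (hfin _ (hP i))
  · exact ENNReal.sum_ne_top.2 fun j _ => hfin _ (hQ j)

/-- Lower semicontinuity always holds. Upper semicontinuity follows since a nearly optimal strictly
feasible point stays feasible for slightly smaller thresholds. -/
theorem continuousAt_expF (hPQ : ∀ a ∈ l.1, P a.1 = Q a.2) (hα : 0 < α)
    (h : strictExpF l P Q α lam ≤ expF l P Q α lam) :
    ContinuousAt (fun r => expF l P Q α r) lam := by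
  refine tendsto_order.2 ⟨fun c hc => ?_, fun c hc => ?_⟩
  · obtain ⟨d, hd1, hd2⟩ := exists_between hc
    have hcont : ContinuousAt (fun r : ℝ => (α, r)) lam := by fun_prop
    filter_upwards [hcont.eventually (eventually_lt_expF hPQ hα hd2)] with r hr
    exact hd1.trans_le hr
  · obtain ⟨r, hr, hrc⟩ := exists_lt_expF_lt (h.trans_lt hc)
    filter_upwards [lt_mem_nhds hr] with r' hr'
    exact (expF_antitone hr'.le).trans_lt hrc

theorem finite_discontinuities (hPQ : ∀ a ∈ l.1, P a.1 = Q a.2) (hα : 0 < α) :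
    {lam : ℝ | 0 < lam ∧ ¬ ContinuousAt (fun r : ℝ => expF l P Q α r) lam}.Finite := by
  -- For each pair this is the set of thresholds feasible at finite cost. Above its infimum some
  -- smaller threshold is feasible, which supplies the strict point for `strictExpF_le_expE`, so
  -- only the infima can be discontinuities.
  set S : Hyp M₁ M₂ K × Hyp M₁ M₂ K → Set ℝ := fun ts => {r : ℝ | 0 ≤ r ∧ ∃ Ω Ψ,
    score ts.1 Ω Ψ α ≤ ENNReal.ofReal r ∧ score ts.2 Ω Ψ α ≤ ENNReal.ofReal r ∧
      cost α P Q Ω Ψ ≠ ⊤} with hS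
  refine (Set.finite_range fun ts => sInf (S ts)).subset ?_
  rintro lam ⟨hlam, hnc⟩
  by_contra hnot
  refine hnc (continuousAt_expF hPQ hα (le_of_forall_gt fun c hc => ?_))
  obtain ⟨t, s, hts, Ω, Ψ, ht, hs, hE⟩ := expF_lt_iff.1 hc
  have hmem : lam ∈ S (t, s) := ⟨hlam.le, Ω, Ψ, ht, hs, by
    rw [← expE_eq_cost l hPQ]
    exact hE.ne_top⟩
  have hlt : sInf (S (t, s)) < lam := lt_of_le_of_ne (csInf_le ⟨0, fun r hr => hr.1⟩ hmem)
    fun h => hnot ⟨(t, s), h⟩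
  obtain ⟨r, ⟨hr0, Ω', Ψ', ht', hs', hE'⟩, hr⟩ := exists_lt_of_csInf_lt ⟨lam, hmem⟩ hlt
  have hlt' : ENNReal.ofReal r < ENNReal.ofReal lam := (ENNReal.ofReal_lt_ofReal_iff hlam).2 hr
  exact (strictExpF_le_expE hPQ hα hts ht hs (ht'.trans_lt hlt') (hs'.trans_lt hlt') hE').trans_lt hE

end

end

/-! ### Probabilities of events and likelihood ratios -/

section

variable {X : Type*} [Fintype X] {M₁ M₂ K N n : ℕ}

open Classical in
/-- The probability that the databases satisfy `A`. -/
def prob (P : Fin M₁ → stdSimplex ℝ X) (Q : Fin M₂ → stdSimplex ℝ X)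
    (A : (Fin M₁ → Fin N → X) → (Fin M₂ → Fin n → X) → Prop) : ℝ :=
  ∑ x, ∑ y, if A x y then dataProb P Q x y else 0

theorem mismatch_eq_prob (φ : Test X M₁ M₂ K N n) (l : Hyp M₁ M₂ K) (P : Fin M₁ → stdSimplex ℝ X)
    (Q : Fin M₂ → stdSimplex ℝ X) :
    mismatch φ l P Q = prob P Q fun x y => φ x y ≠ some l ∧ φ x y ≠ none := by
  unfold mismatch prob
  congr!

theorem falseReject_eq_prob (φ : Test X M₁ M₂ K N n) (P : Fin M₁ → stdSimplex ℝ X)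
    (Q : Fin M₂ → stdSimplex ℝ X) :
    falseReject φ P Q = prob P Q fun x y => φ x y = none := by
  unfold falseReject prob
  congr!

theorem dataProb_nonneg (P : Fin M₁ → stdSimplex ℝ X) (Q : Fin M₂ → stdSimplex ℝ X)
    (x : Fin M₁ → Fin N → X) (y : Fin M₂ → Fin n → X) : 0 ≤ dataProb P Q x y :=
  mul_nonneg
    (Finset.prod_nonneg fun _ _ => Finset.prod_nonneg fun _ _ => stdSimplex.zero_le _ _)
    (Finset.prod_nonneg fun _ _ => Finset.prod_nonneg fun _ _ => stdSimplex.zero_le _ _)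

/-- Independence in product form. It is used both for the total mass and for the exponential moment
of the log-likelihood ratio. -/
theorem sum_prod_prod (F : Fin M₁ → X → ℝ) (G : Fin M₂ → X → ℝ) :
    ∑ x : Fin M₁ → Fin N → X, ∑ y : Fin M₂ → Fin n → X,
        (∏ i, ∏ k, F i (x i k)) * ∏ j, ∏ k, G j (y j k)
      = (∏ i, (∑ a, F i a) ^ N) * ∏ j, (∑ a, G j a) ^ n := by
  have h : ∀ (M L : ℕ) (H : Fin M → X → ℝ),
      ∑ x : Fin M → Fin L → X, ∏ i, ∏ k, H i (x i k) = ∏ i, (∑ a, H i a) ^ L := by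
    intro M L H
    simp_rw [Fintype.sum_pow]
    rw [Finset.prod_univ_sum, Fintype.piFinset_univ]
  rw [← h, ← h, Finset.sum_mul_sum]

theorem sum_dataProb (P : Fin M₁ → stdSimplex ℝ X) (Q : Fin M₂ → stdSimplex ℝ X) :
    ∑ x : Fin M₁ → Fin N → X, ∑ y : Fin M₂ → Fin n → X, dataProb P Q x y = 1 := by
  unfold dataProb
  rw [sum_prod_prod (fun i a => P i a) (fun j a => Q j a)]
  simp

theorem prob_nonneg (P : Fin M₁ → stdSimplex ℝ X) (Q : Fin M₂ → stdSimplex ℝ X)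
    (A : (Fin M₁ → Fin N → X) → (Fin M₂ → Fin n → X) → Prop) : 0 ≤ prob P Q A := by
  refine Finset.sum_nonneg fun x _ => Finset.sum_nonneg fun y _ => ?_
  split_ifs
  exacts [dataProb_nonneg P Q x y, le_rfl]

/-- The log-likelihood ratio of `(Ω, Ψ)` against `(P, Q)`. -/
def logRatio (P Ω : Fin M₁ → stdSimplex ℝ X) (Q Ψ : Fin M₂ → stdSimplex ℝ X)
    (x : Fin M₁ → Fin N → X) (y : Fin M₂ → Fin n → X) : ℝ :=
  ∑ i, ∑ k, Real.log (Ω i (x i k) / P i (x i k)) + ∑ j, ∑ k, Real.log (Ψ j (y j k) / Q j (y j k))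

theorem dataProb_ne_zero_iff (P : Fin M₁ → stdSimplex ℝ X) (Q : Fin M₂ → stdSimplex ℝ X)
    (x : Fin M₁ → Fin N → X) (y : Fin M₂ → Fin n → X) :
    dataProb P Q x y ≠ 0 ↔ (∀ i k, P i (x i k) ≠ 0) ∧ ∀ j k, Q j (y j k) ≠ 0 := by
  simp [dataProb, Finset.prod_ne_zero_iff]

theorem dataProb_eq_exp_logRatio_mul {P Ω : Fin M₁ → stdSimplex ℝ X} {Q Ψ : Fin M₂ → stdSimplex ℝ X}
    {x : Fin M₁ → Fin N → X} {y : Fin M₂ → Fin n → X} (h : dataProb Ω Ψ x y ≠ 0)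
    (h' : dataProb P Q x y ≠ 0) :
    dataProb Ω Ψ x y = Real.exp (logRatio P Ω Q Ψ x y) * dataProb P Q x y := by
  rw [dataProb_ne_zero_iff] at h h'
  have key : ∀ (u v : stdSimplex ℝ X) (a : X), u a ≠ 0 → v a ≠ 0 →
      u a = Real.exp (Real.log (u a / v a)) * v a := by
    intro u v a hu hv
    have hu' := lt_of_le_of_ne (stdSimplex.zero_le u a) hu.symm
    have hv' := lt_of_le_of_ne (stdSimplex.zero_le v a) hv.symm
    rw [Real.exp_log (div_pos hu' hv')]
    field_simp
  rw [logRatio, Real.exp_add, dataProb, dataProb, mul_mul_mul_comm]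
  simp only [Real.exp_sum, ← Finset.prod_mul_distrib]
  congr 1
  · exact Finset.prod_congr rfl fun i _ => Finset.prod_congr rfl fun k _ =>
      key _ _ _ (h.1 i k) (h'.1 i k)
  · exact Finset.prod_congr rfl fun j _ => Finset.prod_congr rfl fun k _ =>
      key _ _ _ (h.2 j k) (h'.2 j k)

theorem cost_ne_top {α : ℝ} (hα : 0 < α) {P Ω : Fin M₁ → stdSimplex ℝ X}
    {Q Ψ : Fin M₂ → stdSimplex ℝ X} (h : cost α P Q Ω Ψ ≠ ⊤) :
    (∀ i x, P i x = 0 → Ω i x = 0) ∧ ∀ j x, Q j x = 0 → Ψ j x = 0 := by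
  rw [cost, ENNReal.add_ne_top, ENNReal.sum_ne_top, ENNReal.sum_ne_top] at h
  refine ⟨fun i => (kl_ne_top_iff _ _).1 fun h' => h.1 i (Finset.mem_univ i) ?_,
    fun j => (kl_ne_top_iff _ _).1 (h.2 j (Finset.mem_univ j))⟩
  rw [h', ENNReal.mul_top (by simpa using hα)]

theorem cost_of_ac {α : ℝ} (hα : 0 ≤ α) {P Ω : Fin M₁ → stdSimplex ℝ X}
    {Q Ψ : Fin M₂ → stdSimplex ℝ X} (hP : ∀ i x, P i x = 0 → Ω i x = 0)
    (hQ : ∀ j x, Q j x = 0 → Ψ j x = 0) :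
    cost α P Q Ω Ψ
      = ENNReal.ofReal (α * ∑ i, klReal (Ω i) (P i) + ∑ j, klReal (Ψ j) (Q j)) := by
  have h1 := fun i => kl_of_ac (Ω i) (P i) (hP i)
  have h2 := fun j => kl_of_ac (Ψ j) (Q j) (hQ j)
  rw [ENNReal.ofReal_add (mul_nonneg hα (Finset.sum_nonneg fun i _ => (h1 i).2))
    (Finset.sum_nonneg fun j _ => (h2 j).2), ENNReal.ofReal_mul hα,
    ENNReal.ofReal_sum_of_nonneg fun i _ => (h1 i).2,
    ENNReal.ofReal_sum_of_nonneg fun j _ => (h2 j).2, Finset.mul_sum, cost]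
  simp_rw [(h1 _).1, (h2 _).1]

/-! ### Method of types -/

/-- The number of occurrences of each symbol in a sequence. -/
def symbolCount {Y : Type*} {L : ℕ} (u : Fin L → Y) (a : Y) : Fin (L + 1) := by
  classical
  exact ⟨(Finset.univ.filter fun k => u k = a).card,
    Nat.lt_succ_of_le ((Finset.card_le_univ _).trans (by simp))⟩

theorem sum_comp_eq_sum_symbolCount {L : ℕ} (u : Fin L → X) (f : X → ℝ) :
    ∑ k, f (u k) = ∑ a, (symbolCount u a : ℝ) * f a := by
  classical
  have h : ∀ a, (symbolCount u a : ℝ) * f a = ∑ k, if u k = a then f a else 0 := by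
    intro a
    rw [← Finset.sum_filter, Finset.sum_const, nsmul_eq_mul]
    simp [symbolCount]
  simp_rw [h]
  rw [Finset.sum_comm]
  simp

theorem symbolCount_ne_zero {Y : Type*} {L : ℕ} {u : Fin L → Y} {a : Y} :
    (symbolCount u a : ℕ) ≠ 0 ↔ ∃ k, u k = a := by
  classical
  simp [symbolCount, Finset.filter_eq_empty_iff]

/-- The empirical distribution (type) of a nonempty sequence. -/
def empirical {L : ℕ} (hL : 0 < L) (u : Fin L → X) : stdSimplex ℝ X :=
  ⟨fun a => (symbolCount u a : ℝ) / L, fun a => by positivity, by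
    have h := sum_comp_eq_sum_symbolCount u fun _ => 1
    simp only [mul_one, Finset.sum_const, Finset.card_univ, Fintype.card_fin, nsmul_eq_mul] at h
    rw [← Finset.sum_div, ← h, div_self (by positivity)]⟩

theorem empirical_apply {L : ℕ} (hL : 0 < L) (u : Fin L → X) (a : X) :
    empirical hL u a = (symbolCount u a : ℝ) / L := rfl

theorem empirical_apply_ne_zero {L : ℕ} (hL : 0 < L) (u : Fin L → X) (k : Fin L) :
    empirical hL u (u k) ≠ 0 := by
  have h : (symbolCount u (u k) : ℕ) ≠ 0 := symbolCount_ne_zero.2 ⟨k, rfl⟩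
  rw [empirical_apply]
  exact div_ne_zero (Nat.cast_ne_zero.2 h) (by positivity)

theorem sum_comp_eq_mul_sum_empirical {L : ℕ} (hL : 0 < L) (u : Fin L → X) (f : X → ℝ) :
    ∑ k, f (u k) = L * ∑ a, empirical hL u a * f a := by
  rw [sum_comp_eq_sum_symbolCount, Finset.mul_sum]
  refine Finset.sum_congr rfl fun a _ => ?_
  rw [empirical_apply]
  field_simp

/-- For data of positive probability, the likelihood ratio of the empirical tuple against `(P, Q)`
is exactly the exponential of `n` times the cost with weight `N / n`. -/
theorem dataProb_le_of_le_cost (hN : 0 < N) (hn : 0 < n) (P : Fin M₁ → stdSimplex ℝ X)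
    (Q : Fin M₂ → stdSimplex ℝ X) (x : Fin M₁ → Fin N → X) (y : Fin M₂ → Fin n → X) {c : ℝ}
    (hc : ENNReal.ofReal c ≤ cost ((N : ℝ) / n) P Q (fun i => empirical hN (x i))
      (fun j => empirical hn (y j))) :
    dataProb P Q x y ≤ Real.exp (-(n * c))
      * dataProb (fun i => empirical hN (x i)) (fun j => empirical hn (y j)) x y := by
  set Ω := fun i => empirical hN (x i) with hΩ
  set Ψ := fun j => empirical hn (y j) with hΨ
  by_cases h0 : dataProb P Q x y = 0
  · rw [h0]
    exact mul_nonneg (Real.exp_pos _).le (dataProb_nonneg _ _ _ _)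
  have hne : dataProb Ω Ψ x y ≠ 0 := (dataProb_ne_zero_iff _ _ _ _).2
    ⟨fun i k => empirical_apply_ne_zero hN (x i) k, fun j k => empirical_apply_ne_zero hn (y j) k⟩
  have h0' := (dataProb_ne_zero_iff _ _ _ _).1 h0
  have hac : ∀ (L : ℕ) (hL : 0 < L) (u : Fin L → X) (p : stdSimplex ℝ X), (∀ k, p (u k) ≠ 0) →
      ∀ a, p a = 0 → empirical hL u a = 0 := by
    intro L hL u p hp a ha
    by_contra hne
    rw [empirical_apply] at hne
    obtain ⟨k, hk⟩ := symbolCount_ne_zero.1 (Nat.cast_ne_zero.1 (div_ne_zero_iff.1 hne).1)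
    exact hp k (hk ▸ ha)
  have hP : ∀ i a, P i a = 0 → Ω i a = 0 := fun i => hac N hN (x i) (P i) (h0'.1 i)
  have hQ : ∀ j a, Q j a = 0 → Ψ j a = 0 := fun j => hac n hn (y j) (Q j) (h0'.2 j)
  have hLR : logRatio P Ω Q Ψ x y
      = n * ((N : ℝ) / n * ∑ i, klReal (Ω i) (P i) + ∑ j, klReal (Ψ j) (Q j)) := by
    have hn' : (n : ℝ) ≠ 0 := by positivity
    rw [mul_add, ← mul_assoc, mul_div_cancel₀ _ hn', Finset.mul_sum, Finset.mul_sum, logRatio]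
    congr 1
    · exact Finset.sum_congr rfl fun i _ => sum_comp_eq_mul_sum_empirical hN (x i)
        fun a => Real.log (Ω i a / P i a)
    · exact Finset.sum_congr rfl fun j _ => sum_comp_eq_mul_sum_empirical hn (y j)
        fun a => Real.log (Ψ j a / Q j a)
  have hnn : 0 ≤ (N : ℝ) / n * ∑ i, klReal (Ω i) (P i) + ∑ j, klReal (Ψ j) (Q j) :=
    add_nonneg (mul_nonneg (by positivity)
      (Finset.sum_nonneg fun i _ => (kl_of_ac _ _ (hP i)).2))
      (Finset.sum_nonneg fun j _ => (kl_of_ac _ _ (hQ j)).2)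
  rw [cost_of_ac (by positivity) hP hQ, ENNReal.ofReal_le_ofReal_iff hnn] at hc
  rw [dataProb_eq_exp_logRatio_mul hne h0, ← mul_assoc, ← Real.exp_add, hLR]
  refine le_mul_of_one_le_left (dataProb_nonneg _ _ _ _) (Real.one_le_exp ?_)
  have := mul_le_mul_of_nonneg_left hc (Nat.cast_nonneg (α := ℝ) n)
  linarith

/-- An upper bound for the number of pairs of types of the two databases. -/
def typeBound (X : Type*) [Fintype X] (M₁ M₂ N n : ℕ) : ℕ :=
  ((N + 1) ^ Fintype.card X) ^ M₁ * ((n + 1) ^ Fintype.card X) ^ M₂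

theorem typeBound_pos (X : Type*) [Fintype X] (M₁ M₂ N n : ℕ) : 0 < typeBound X M₁ M₂ N n := by
  unfold typeBound
  positivity

/-- Group the data by symbol counts: on one type class the empirical tuple is constant, so the class
contributes a probability, at most one. -/
theorem sum_dataProb_empirical_le (hN : 0 < N) (hn : 0 < n) :
    ∑ x : Fin M₁ → Fin N → X, ∑ y : Fin M₂ → Fin n → X,
        dataProb (fun i => empirical hN (x i)) (fun j => empirical hn (y j)) x y
      ≤ typeBound X M₁ M₂ N n := by
  classical
  set cnt : (Fin M₁ → Fin N → X) × (Fin M₂ → Fin n → X) →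
    (Fin M₁ → X → Fin (N + 1)) × (Fin M₂ → X → Fin (n + 1)) :=
    fun z => (fun i => symbolCount (z.1 i), fun j => symbolCount (z.2 j)) with hcnt
  have hcard : Fintype.card ((Fin M₁ → X → Fin (N + 1)) × (Fin M₂ → X → Fin (n + 1)))
      = typeBound X M₁ M₂ N n := by
    simp [typeBound]
  rw [← Fintype.sum_prod_type', ← Finset.sum_fiberwise _ cnt, ← hcard, ← Finset.card_univ,
    Finset.card_eq_sum_ones, Nat.cast_sum]
  refine Finset.sum_le_sum fun v _ => ?_
  rw [Nat.cast_one]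
  by_cases hv : ∃ z₀, cnt z₀ = v
  · obtain ⟨z₀, rfl⟩ := hv
    rw [← sum_dataProb (N := N) (n := n) (fun i => empirical hN (z₀.1 i))
      (fun j => empirical hn (z₀.2 j)), ← Fintype.sum_prod_type']
    refine (Finset.sum_congr rfl fun z hz => ?_).trans_le
      (Finset.sum_le_sum_of_subset_of_nonneg (Finset.filter_subset _ _)
        fun z _ _ => dataProb_nonneg _ _ _ _)
    have hz' : cnt z = cnt z₀ := (Finset.mem_filter.1 hz).2
    have h1 : ∀ i, empirical hN (z.1 i) = empirical hN (z₀.1 i) := fun i => by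
      have := congrFun (congrArg Prod.fst hz') i
      simp only [hcnt] at this
      simp only [empirical, this]
    have h2 : ∀ j, empirical hn (z.2 j) = empirical hn (z₀.2 j) := fun j => by
      have := congrFun (congrArg Prod.snd hz') j
      simp only [hcnt] at this
      simp only [empirical, this]
    simp_rw [h1, h2]
  · rw [Finset.sum_eq_zero fun z hz => absurd ⟨z, (Finset.mem_filter.1 hz).2⟩ hv]
    exact zero_le_one

/-- Method of types: an event all of whose types cost at least `c` has probability at most
`exp (-n c)` up to the number of types. -/
theorem prob_le_of_le_cost (hN : 0 < N) (hn : 0 < n) (P : Fin M₁ → stdSimplex ℝ X)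
    (Q : Fin M₂ → stdSimplex ℝ X) (A : (Fin M₁ → Fin N → X) → (Fin M₂ → Fin n → X) → Prop) {c : ℝ}
    (hA : ∀ x y, A x y → ENNReal.ofReal c ≤ cost ((N : ℝ) / n) P Q (fun i => empirical hN (x i))
      (fun j => empirical hn (y j))) :
    prob P Q A ≤ typeBound X M₁ M₂ N n * Real.exp (-(n * c)) := by
  refine le_trans ?_ (mul_le_mul_of_nonneg_right (sum_dataProb_empirical_le hN hn)
    (Real.exp_pos _).le)
  rw [mul_comm, Finset.mul_sum]
  refine Finset.sum_le_sum fun x _ => ?_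
  rw [Finset.mul_sum]
  refine Finset.sum_le_sum fun y _ => ?_
  split_ifs with h
  · exact dataProb_le_of_le_cost hN hn P Q x y (hA x y h)
  · exact mul_nonneg (Real.exp_pos _).le (dataProb_nonneg _ _ _ _)

/-! ### Change of measure -/

/-- Combines `exp u ≤ 1 + u + u ^ 2` for `|u| ≤ 1`, averaged over `p`, with `1 + v ≤ exp v`. -/
theorem sum_mul_exp_le {θ C : ℝ} (hC : θ * C ≤ 1) (hθ : 0 ≤ θ) (p q : stdSimplex ℝ X)
    (hf : ∀ a, |Real.log (p a / q a)| ≤ C) :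
    ∑ a, p a * Real.exp (θ * Real.log (p a / q a))
      ≤ Real.exp (θ * klReal p q + θ ^ 2 * C ^ 2) := by
  have h : ∀ a, p a * Real.exp (θ * Real.log (p a / q a))
      ≤ p a + θ * (p a * Real.log (p a / q a)) + p a * (θ ^ 2 * C ^ 2) := by
    intro a
    have h1 : |θ * Real.log (p a / q a)| ≤ θ * C := by
      rw [abs_mul, abs_of_nonneg hθ]
      exact mul_le_mul_of_nonneg_left (hf a) hθ
    have h2 := (abs_le.1 (Real.abs_exp_sub_one_sub_id_le (h1.trans hC))).2
    have h3 : (θ * Real.log (p a / q a)) ^ 2 ≤ θ ^ 2 * C ^ 2 := by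
      rw [← mul_pow]
      exact sq_le_sq' (abs_le.1 h1).1 (abs_le.1 h1).2
    nlinarith [stdSimplex.zero_le p a]
  refine (Finset.sum_le_sum fun a _ => h a).trans ?_
  rw [Finset.sum_add_distrib, Finset.sum_add_distrib, ← Finset.mul_sum, ← Finset.sum_mul,
    stdSimplex.sum_eq_one, one_mul, ← klReal]
  have := Real.add_one_le_exp (θ * klReal p q + θ ^ 2 * C ^ 2)
  linarith

theorem sum_dataProb_mul_exp_logRatio_le {θ C : ℝ} (hC : θ * C ≤ 1) (hθ : 0 ≤ θ)
    (P Ω : Fin M₁ → stdSimplex ℝ X) (Q Ψ : Fin M₂ → stdSimplex ℝ X)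
    (hP : ∀ i a, |Real.log (Ω i a / P i a)| ≤ C) (hQ : ∀ j a, |Real.log (Ψ j a / Q j a)| ≤ C) :
    ∑ x : Fin M₁ → Fin N → X, ∑ y : Fin M₂ → Fin n → X,
        dataProb Ω Ψ x y * Real.exp (θ * logRatio P Ω Q Ψ x y)
      ≤ Real.exp (N * (θ * ∑ i, klReal (Ω i) (P i) + M₁ * (θ ^ 2 * C ^ 2))
        + n * (θ * ∑ j, klReal (Ψ j) (Q j) + M₂ * (θ ^ 2 * C ^ 2))) := by
  have h : ∀ (x : Fin M₁ → Fin N → X) (y : Fin M₂ → Fin n → X),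
      dataProb Ω Ψ x y * Real.exp (θ * logRatio P Ω Q Ψ x y)
      = (∏ i, ∏ k, Ω i (x i k) * Real.exp (θ * Real.log (Ω i (x i k) / P i (x i k))))
        * ∏ j, ∏ k, Ψ j (y j k) * Real.exp (θ * Real.log (Ψ j (y j k) / Q j (y j k))) := by
    intro x y
    simp only [Finset.prod_mul_distrib, ← Real.exp_sum, logRatio, mul_add, Real.exp_add,
      Finset.mul_sum, dataProb]
    ring
  simp_rw [h]
  rw [sum_prod_prod (fun i a => Ω i a * Real.exp (θ * Real.log (Ω i a / P i a)))
    (fun j a => Ψ j a * Real.exp (θ * Real.log (Ψ j a / Q j a))), Real.exp_add]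
  have hprod : ∀ (M L : ℕ) (p q : Fin M → stdSimplex ℝ X),
      (∀ i a, |Real.log (p i a / q i a)| ≤ C) →
      ∏ i, (∑ a, p i a * Real.exp (θ * Real.log (p i a / q i a))) ^ L
        ≤ Real.exp (L * (θ * ∑ i, klReal (p i) (q i) + M * (θ ^ 2 * C ^ 2))) := by
    intro M L p q hpq
    have hnn : ∀ i, 0 ≤ ∑ a, p i a * Real.exp (θ * Real.log (p i a / q i a)) := fun i =>
      Finset.sum_nonneg fun a _ => mul_nonneg (stdSimplex.zero_le _ _) (Real.exp_pos _).le
    refine (Finset.prod_le_prod (fun i _ => pow_nonneg (hnn i) L) fun i _ =>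
      pow_le_pow_left₀ (hnn i) (sum_mul_exp_le hC hθ (p i) (q i) (hpq i)) L).trans (le_of_eq ?_)
    simp_rw [← Real.exp_nat_mul]
    rw [← Real.exp_sum, ← Finset.mul_sum, Finset.sum_add_distrib, ← Finset.mul_sum]
    simp
  refine mul_le_mul (hprod M₁ N Ω P hP) (hprod M₂ n Ψ Q hQ) (Finset.prod_nonneg fun j _ =>
    pow_nonneg (Finset.sum_nonneg fun a _ => mul_nonneg (stdSimplex.zero_le _ _)
      (Real.exp_pos _).le) n) (Real.exp_pos _).le

/-- Change of measure: if `(Ω, Ψ)` costs less than `c` with respect to `(P, Q)`, then every event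
has probability at most `exp (n c)` times its probability under `(P, Q)`, up to `o(1)`. -/
theorem exists_change_of_measure {α : ℝ} (hα : 0 < α) {L : ℕ → ℕ}
    (hL : Tendsto (fun n : ℕ => (L n : ℝ) / (n : ℝ)) atTop (𝓝 α))
    {P Ω : Fin M₁ → stdSimplex ℝ X} {Q Ψ : Fin M₂ → stdSimplex ℝ X} {c : ℝ}
    (hc : cost α P Q Ω Ψ < ENNReal.ofReal c) :
    ∃ δ : ℕ → ℝ, Tendsto δ atTop (𝓝 0) ∧ ∀ n, 0 < n →
      ∀ A : (Fin M₁ → Fin (L n) → X) → (Fin M₂ → Fin n → X) → Prop,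
        prob Ω Ψ A ≤ Real.exp (n * c) * prob P Q A + δ n := by
  obtain ⟨hP, hQ⟩ := cost_ne_top hα hc.ne_top
  rw [cost_of_ac hα.le hP hQ] at hc
  have hc' := (ENNReal.ofReal_lt_ofReal_iff').1 hc |>.1
  set a := ∑ i, klReal (Ω i) (P i) with ha
  set b := ∑ j, klReal (Ψ j) (Q j) with hb
  obtain ⟨C, hCP, hCQ⟩ : ∃ C : ℝ, (∀ i x, |Real.log (Ω i x / P i x)| ≤ C) ∧
      ∀ j x, |Real.log (Ψ j x / Q j x)| ≤ C := by
    obtain ⟨C₁, h₁⟩ := (Set.finite_range fun z : Fin M₁ × X =>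
      |Real.log (Ω z.1 z.2 / P z.1 z.2)|).bddAbove
    obtain ⟨C₂, h₂⟩ := (Set.finite_range fun z : Fin M₂ × X =>
      |Real.log (Ψ z.1 z.2 / Q z.1 z.2)|).bddAbove
    exact ⟨max C₁ C₂, fun i x => (h₁ ⟨(i, x), rfl⟩).trans (le_max_left _ _),
      fun j x => (h₂ ⟨(j, x), rfl⟩).trans (le_max_right _ _)⟩
  -- The mean `α * a + b` of the normalized log-likelihood ratio is below `c`, so for small `θ` the
  -- quadratic error cannot spoil the negative Chernoff exponent.
  obtain ⟨θ, hθ0, hθC, hθneg⟩ : ∃ θ : ℝ, 0 < θ ∧ θ * C ≤ 1 ∧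
      (α * a + b - c) + θ * (C ^ 2 * (α * M₁ + M₂)) < 0 := by
    have h1 : ∀ᶠ θ : ℝ in 𝓝[>] 0, θ * C < 1 := by
      have : ContinuousAt (fun θ : ℝ => θ * C) 0 := by fun_prop
      exact (this.eventually (gt_mem_nhds (by simp))).filter_mono nhdsWithin_le_nhds
    have h2 : ∀ᶠ θ : ℝ in 𝓝[>] 0, (α * a + b - c) + θ * (C ^ 2 * (α * M₁ + M₂)) < 0 := by
      have : ContinuousAt (fun θ : ℝ => (α * a + b - c) + θ * (C ^ 2 * (α * M₁ + M₂))) 0 := by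
        fun_prop
      refine (this.eventually (gt_mem_nhds ?_)).filter_mono nhdsWithin_le_nhds
      linarith
    obtain ⟨θ, hθ, hθ1, hθ2⟩ := (h1.and (h2.and self_mem_nhdsWithin)).exists
    exact ⟨θ, hθ2, hθ.le, hθ1⟩
  set g : ℕ → ℝ := fun n => θ * (((L n : ℝ) / n * a + b - c)
    + θ * (C ^ 2 * ((L n : ℝ) / n * M₁ + M₂))) with hg
  have hglim : Tendsto g atTop (𝓝 (θ * ((α * a + b - c) + θ * (C ^ 2 * (α * M₁ + M₂))))) :=
    (((((hL.mul_const a).add_const b).sub_const c)).add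
      ((((hL.mul_const _).add_const _).const_mul _).const_mul θ)).const_mul θ
  refine ⟨fun n => Real.exp (n * g n), Real.tendsto_exp_atBot.comp
    (tendsto_natCast_atTop_atTop.atTop_mul_neg (mul_neg_of_pos_of_neg hθ0 hθneg) hglim),
    fun n hn A => ?_⟩
  have hn' : (n : ℝ) ≠ 0 := by positivity
  -- Where the log-likelihood ratio is at most `n * c` the first term dominates; elsewhere the
  -- exponential Markov bound gives the second.
  have hpt : ∀ (x : Fin M₁ → Fin (L n) → X) (y : Fin M₂ → Fin n → X),
      dataProb Ω Ψ x y ≤ Real.exp (n * c) * dataProb P Q x y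
        + Real.exp (-(θ * (n * c))) * (dataProb Ω Ψ x y * Real.exp (θ * logRatio P Ω Q Ψ x y)) := by
    intro x y
    have h0 := dataProb_nonneg Ω Ψ x y
    have h0' := dataProb_nonneg P Q x y
    rcases h0.eq_or_lt with hz | hz
    · rw [← hz, zero_mul, mul_zero, add_zero]
      positivity
    by_cases hr : logRatio P Ω Q Ψ x y ≤ n * c
    · have hΩ := (dataProb_ne_zero_iff _ _ _ _).1 hz.ne'
      have hne : dataProb P Q x y ≠ 0 := (dataProb_ne_zero_iff _ _ _ _).2
        ⟨fun i k h => hΩ.1 i k (hP i _ h), fun j k h => hΩ.2 j k (hQ j _ h)⟩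
      refine le_add_of_le_of_nonneg ?_ (by positivity)
      rw [dataProb_eq_exp_logRatio_mul hz.ne' hne]
      gcongr
    · refine le_add_of_nonneg_of_le (by positivity) ?_
      rw [mul_left_comm, ← Real.exp_add]
      refine le_mul_of_one_le_right h0 (Real.one_le_exp ?_)
      nlinarith
  have hS := sum_dataProb_mul_exp_logRatio_le (N := L n) (n := n) hθC hθ0.le P Ω Q Ψ hCP hCQ
  calc prob Ω Ψ A
      ≤ ∑ x, ∑ y, (Real.exp (n * c) * (@ite _ (A x y) (Classical.dec _) (dataProb P Q x y) 0)
        + Real.exp (-(θ * (n * c)))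
          * (dataProb Ω Ψ x y * Real.exp (θ * logRatio P Ω Q Ψ x y))) := by
        refine Finset.sum_le_sum fun x _ => Finset.sum_le_sum fun y _ => ?_
        split_ifs
        · exact hpt x y
        · have := dataProb_nonneg Ω Ψ x y
          positivity
    _ = Real.exp (n * c) * prob P Q A + Real.exp (-(θ * (n * c))) * ∑ x, ∑ y,
          (dataProb Ω Ψ x y * Real.exp (θ * logRatio P Ω Q Ψ x y)) := by
        simp only [Finset.sum_add_distrib, prob, Finset.mul_sum]
        congr!
    _ ≤ Real.exp (n * c) * prob P Q A + Real.exp (n * g n) := by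
        refine add_le_add le_rfl ((mul_le_mul_of_nonneg_left hS (Real.exp_pos _).le).trans
          (le_of_eq ?_))
        rw [← Real.exp_add]
        congr 1
        simp only [hg]
        field_simp
        ring

end

/-! ### Converse bound -/

section

variable {X : Type*} [Fintype X] {M₁ M₂ K N n : ℕ}

theorem infinite_stdSimplex (X : Type*) [Fintype X] [Nontrivial X] :
    Infinite (stdSimplex ℝ X) := by
  classical
  obtain ⟨a, b, hab⟩ := exists_pair_ne X
  have : Infinite unitInterval := (Set.Icc_infinite (zero_lt_one' ℝ)).to_subtype
  refine Infinite.of_injective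
    (fun ε : unitInterval => combo ε (stdSimplex.vertex a) (stdSimplex.vertex b)) ?_
  intro ε ε' h
  have h' := DFunLike.congr_fun h b
  simpa [combo_apply, stdSimplex.vertex_coe, hab.symm, Subtype.ext_iff] using h'

theorem combo_zero (p q : stdSimplex ℝ X) : combo 0 p q = p := by
  refine stdSimplex.ext (funext fun x => ?_)
  simp [combo_apply]

theorem continuous_combo_apply (p q : stdSimplex ℝ X) (x : X) :
    Continuous fun ε : unitInterval => combo ε p q x := by
  simp only [combo_apply]
  fun_prop

theorem continuous_prob_combo (P P' : Fin M₁ → stdSimplex ℝ X) (Q Q' : Fin M₂ → stdSimplex ℝ X)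
    (A : (Fin M₁ → Fin N → X) → (Fin M₂ → Fin n → X) → Prop) :
    Continuous fun ε : unitInterval =>
      prob (fun i => combo ε (P i) (P' i)) (fun j => combo ε (Q j) (Q' j)) A := by
  unfold prob dataProb
  refine continuous_finsetSum _ fun x _ => continuous_finsetSum _ fun y _ => ?_
  split_ifs
  · exact (continuous_finsetProd _ fun i _ => continuous_finsetProd _ fun k _ =>
      continuous_combo_apply _ _ _).mul (continuous_finsetProd _ fun i _ =>
        continuous_finsetProd _ fun k _ => continuous_combo_apply _ _ _)
  · exact continuous_const

/-- In a coordinate where `u` and `v` differ, the difference is affine in `e` and not identically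
zero, so it has no zeros for small positive `e`. -/
theorem eventually_combo_ne (p q : stdSimplex ℝ X) {u v : stdSimplex ℝ X} (h : u ≠ v) :
    ∀ᶠ e : ℝ in 𝓝[>] 0, combo (Set.projIcc 0 1 zero_le_one e) p u
      ≠ combo (Set.projIcc 0 1 zero_le_one e) q v := by
  obtain ⟨x, hx⟩ := DFunLike.ne_iff.1 h
  have key : ∀ᶠ e : ℝ in 𝓝[>] 0, (1 - e) * (p x - q x) + e * (u x - v x) ≠ 0 := by
    by_cases hd : p x - q x = 0
    · filter_upwards [self_mem_nhdsWithin] with e he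
      rw [hd, mul_zero, zero_add]
      exact mul_ne_zero (ne_of_gt he) (sub_ne_zero.2 hx)
    · have : ContinuousAt (fun e : ℝ => (1 - e) * (p x - q x) + e * (u x - v x)) 0 := by fun_prop
      refine (this.eventually_ne ?_).filter_mono nhdsWithin_le_nhds
      simpa using hd
  filter_upwards [key, Ioo_mem_nhdsGT (one_pos : (0 : ℝ) < 1)] with e he he1 heq
  have hval : ((Set.projIcc 0 1 zero_le_one e : unitInterval) : ℝ) = e := by
    rw [Set.projIcc_of_mem _ ⟨he1.1.le, he1.2.le⟩]
  have h' := DFunLike.congr_fun heq x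
  rw [combo_apply, combo_apply, hval] at h'
  apply he
  linarith

/-- The universal constraint extends to the closure of the set of generating tuples. -/
theorem Universal.mismatch_le [Nontrivial X] {φ : Test X M₁ M₂ K N n} {lam : ℝ}
    (hφ : Universal φ lam) (t : Hyp M₁ M₂ K) {P : Fin M₁ → stdSimplex ℝ X}
    {Q : Fin M₂ → stdSimplex ℝ X} (hPQ : ∀ a ∈ t.1, P a.1 = Q a.2) :
    mismatch φ t P Q ≤ Real.exp (-(n * lam)) := by
  classical
  have := infinite_stdSimplex X
  -- Perturbation directions: distinct distributions, shared by `i` and `j` exactly when `(i, j)` is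
  -- matched. Mixing in a small amount keeps the equalities of `t` and destroys all other
  -- coincidences.
  set U : Fin M₁ ⊕ Fin M₂ ↪ stdSimplex ℝ X := (Fintype.equivFin _).toEmbedding.trans
    (Fin.valEmbedding.trans (Infinite.natEmbedding _))
  set cls : Fin M₂ → Fin M₁ ⊕ Fin M₂ := fun j =>
    if h : ∃ i, (i, j) ∈ t.1 then Sum.inl h.choose else Sum.inr j with hcls
  have hcls_iff : ∀ i j, Sum.inl i = cls j ↔ (i, j) ∈ t.1 := by
    intro i j
    simp only [hcls]
    split_ifs with h
    · rw [Sum.inl.injEq]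
      constructor
      · rintro rfl
        exact h.choose_spec
      · intro hij
        exact congrArg Prod.fst (t.injOn_snd hij h.choose_spec rfl)
    · simp only [false_iff]
      exact fun hij => h ⟨i, hij⟩
  set π : ℝ → unitInterval := Set.projIcc 0 1 zero_le_one with hπ
  set F : unitInterval → ℝ := fun ε => prob (fun i => combo ε (P i) (U (Sum.inl i)))
    (fun j => combo ε (Q j) (U (cls j))) fun x y => φ x y ≠ some t ∧ φ x y ≠ none with hF
  have hcont : Continuous (F ∘ π) :=
    (continuous_prob_combo P _ Q _ _).comp continuous_projIcc
  have hπ0 : π 0 = 0 := by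
    rw [hπ, Set.projIcc_left]
    rfl
  have hlim : Tendsto (F ∘ π) (𝓝[>] 0) (𝓝 (mismatch φ t P Q)) := by
    have h := (hcont.tendsto 0).mono_left (nhdsWithin_le_nhds (s := Set.Ioi (0 : ℝ)))
    simp only [Function.comp_apply, hπ0, hF, combo_zero] at h
    rw [mismatch_eq_prob]
    exact h
  refine le_of_tendsto hlim ?_
  have hev : ∀ᶠ e : ℝ in 𝓝[>] 0, ∀ i j, (i, j) ∉ t.1 →
      combo (π e) (P i) (U (Sum.inl i)) ≠ combo (π e) (Q j) (U (cls j)) := by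
    simp only [eventually_all]
    exact fun i j hij => eventually_combo_ne _ _ fun h =>
      hij ((hcls_iff i j).1 (U.injective h))
  filter_upwards [hev] with e he
  simp only [Function.comp_apply, hF]
  rw [← mismatch_eq_prob]
  refine hφ t (_, _) fun i j => ⟨fun h => ?_, fun h => ?_⟩
  · by_contra hij
    exact he i j hij h
  · dsimp only
    rw [hPQ (i, j) h, (hcls_iff i j).2 h]

/-- Over an alphabet with at most one letter all distributions coincide, so `l` contains every pair;
as all hypotheses have `K` pairs, there is only one. -/
theorem nontrivial_of_ne {l t s : Hyp M₁ M₂ K} (hts : t ≠ s) {P : Fin M₁ → stdSimplex ℝ X}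
    {Q : Fin M₂ → stdSimplex ℝ X} (hPQ : (P, Q) ∈ genDist X l) : Nontrivial X := by
  by_contra hX
  rw [not_nontrivial_iff_subsingleton] at hX
  have hl : ∀ a, a ∈ l.1 := fun a => (hPQ a.1 a.2).1 (Subsingleton.elim _ _)
  have h : ∀ u : Hyp M₁ M₂ K, u = l := fun u => Subtype.ext
    (Finset.eq_of_subset_of_card_le (fun a _ => hl a) (by rw [u.2.1, l.2.1]))
  exact hts ((h t).trans (h s).symm)

theorem falseReject_nonneg (φ : Test X M₁ M₂ K N n) (P : Fin M₁ → stdSimplex ℝ X)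
    (Q : Fin M₂ → stdSimplex ℝ X) : 0 ≤ falseReject φ P Q := by
  rw [falseReject_eq_prob]
  exact prob_nonneg _ _ _

theorem optFalseReject_le {φ : Test X M₁ M₂ K N n} {lam : ℝ} (hφ : Universal φ lam)
    (P : Fin M₁ → stdSimplex ℝ X) (Q : Fin M₂ → stdSimplex ℝ X) :
    optFalseReject K N n lam P Q ≤ falseReject φ P Q := by
  refine csInf_le ⟨0, ?_⟩ ⟨φ, hφ, rfl⟩
  rintro _ ⟨ψ, -, rfl⟩
  exact falseReject_nonneg ψ P Q

theorem le_optFalseReject {lam b : ℝ} {P : Fin M₁ → stdSimplex ℝ X} {Q : Fin M₂ → stdSimplex ℝ X}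
    (h : ∀ φ : Test X M₁ M₂ K N n, Universal φ lam → b ≤ falseReject φ P Q) :
    b ≤ optFalseReject K N n lam P Q := by
  refine le_csInf ⟨_, (fun _ _ => none), ?_, rfl⟩ ?_
  · intro t PQ _
    rw [mismatch_eq_prob, prob]
    simp [Real.exp_nonneg]
  · rintro _ ⟨φ, hφ, rfl⟩
    exact h φ hφ

theorem log_ofReal_exp (r : ℝ) : ENNReal.log (ENNReal.ofReal (Real.exp r)) = (r : EReal) := by
  rw [ENNReal.log_ofReal, if_neg (not_le.2 (Real.exp_pos r)), Real.log_exp]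

theorem neg_coe_mul_div (hn : 0 < n) (c : ℝ) : -((-(n * c) : ℝ) : EReal) / (n : EReal) = c := by
  have hn' : (n : ℝ) ≠ 0 := by positivity
  rw [← EReal.coe_neg, neg_neg, ← EReal.coe_natCast, ← EReal.coe_div, mul_div_cancel_left₀ _ hn']

theorem optExponent_le (hn : 0 < n) {lam c : ℝ} {P : Fin M₁ → stdSimplex ℝ X}
    {Q : Fin M₂ → stdSimplex ℝ X} (h : Real.exp (-(n * c)) ≤ optFalseReject K N n lam P Q) :
    optExponent K N n lam P Q ≤ c := by
  rw [← neg_coe_mul_div hn c, optExponent]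
  refine EReal.div_le_div_right_of_nonneg (by positivity) (EReal.neg_le_neg_iff.2 ?_)
  rw [← log_ofReal_exp]
  exact ENNReal.log_monotone (ENNReal.ofReal_le_ofReal h)

theorem le_optExponent (hn : 0 < n) {lam c : ℝ} {P : Fin M₁ → stdSimplex ℝ X}
    {Q : Fin M₂ → stdSimplex ℝ X} (h : optFalseReject K N n lam P Q ≤ Real.exp (-(n * c))) :
    c ≤ optExponent K N n lam P Q := by
  rw [← neg_coe_mul_div hn c, optExponent]
  refine EReal.div_le_div_right_of_nonneg (by positivity) (EReal.neg_le_neg_iff.2 ?_)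
  rw [← log_ofReal_exp]
  exact ENNReal.log_monotone (ENNReal.ofReal_le_ofReal h)

/-- A decision that is not a rejection differs from `t` or from `s`. -/
theorem one_le_prob_add {t s : Hyp M₁ M₂ K} (hts : t ≠ s) (φ : Test X M₁ M₂ K N n)
    (Ω : Fin M₁ → stdSimplex ℝ X) (Ψ : Fin M₂ → stdSimplex ℝ X) :
    1 ≤ prob Ω Ψ (fun x y => φ x y = none)
      + (prob Ω Ψ (fun x y => φ x y ≠ some t ∧ φ x y ≠ none)
        + prob Ω Ψ (fun x y => φ x y ≠ some s ∧ φ x y ≠ none)) := by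
  rw [← sum_dataProb (N := N) (n := n) Ω Ψ]
  simp only [prob, ← Finset.sum_add_distrib]
  refine Finset.sum_le_sum fun x _ => Finset.sum_le_sum fun y _ => ?_
  have h0 := dataProb_nonneg Ω Ψ x y
  by_cases h : φ x y = none
  · simp [h]
  by_cases ht : φ x y = some t
  · simp [ht, hts]
  · rw [if_neg h, if_pos ⟨ht, h⟩]
    split_ifs <;> linarith

theorem exists_real_between_lt_lt {a b : ℝ≥0∞} {lam : ℝ} (ha : a < ENNReal.ofReal lam)
    (hb : b < ENNReal.ofReal lam) :
    ∃ c < lam, a < ENNReal.ofReal c ∧ b < ENNReal.ofReal c := by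
  obtain ⟨d, hd1, hd2⟩ := exists_between (max_lt ha hb)
  refine ⟨d.toReal, (ENNReal.lt_ofReal_iff_toReal_lt hd2.ne_top).1 hd2, ?_⟩
  rw [ENNReal.ofReal_toReal hd2.ne_top]
  exact max_lt_iff.1 hd1

theorem limsup_optExponent_le_strictExpF {α : ℝ} (hα : 0 < α) {L : ℕ → ℕ}
    (hL : Tendsto (fun n : ℕ => (L n : ℝ) / (n : ℝ)) atTop (𝓝 α)) {l : Hyp M₁ M₂ K}
    {P : Fin M₁ → stdSimplex ℝ X} {Q : Fin M₂ → stdSimplex ℝ X} (hPQ : (P, Q) ∈ genDist X l)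
    (lam : ℝ) :
    limsup (fun n : ℕ => optExponent K (L n) n lam P Q) atTop
      ≤ ((strictExpF l P Q α lam : ℝ≥0∞) : EReal) := by
  have hPQ' : ∀ a ∈ l.1, P a.1 = Q a.2 := fun a ha => (hPQ a.1 a.2).2 ha
  refine le_of_forall_gt fun d hd => ?_
  obtain ⟨c, hc1, hc2⟩ := EReal.lt_iff_exists_real_btwn.1 hd
  refine lt_of_le_of_lt ?_ hc2
  have hc : strictExpF l P Q α lam < ENNReal.ofReal c := by
    rw [← EReal.coe_ennreal_lt_coe_ennreal_iff, EReal.coe_ennreal_ofReal]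
    exact hc1.trans_le (EReal.coe_le_coe_iff.2 (le_max_left c 0))
  obtain ⟨t, s, hts, Ω, Ψ, ht, hs, hE⟩ := strictExpF_lt_iff.1 hc
  have := nontrivial_of_ne hts hPQ
  rw [expE_eq_cost l hPQ'] at hE
  -- A level `c₁` strictly between the scores and `lam`: change of measure costs `exp (n * c₁)`,
  -- which the constraint `exp (-(n * lam))` beats.
  obtain ⟨c₁, hc₁, ht₁, hs₁⟩ := exists_real_between_lt_lt ht hs
  obtain ⟨Pt, Qt, hPQt, hct⟩ := exists_cost_le_score hα t Ω Ψ
  obtain ⟨Ps, Qs, hPQs, hcs⟩ := exists_cost_le_score hα s Ω Ψ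
  obtain ⟨δ, hδ, hδ'⟩ := exists_change_of_measure hα hL hE
  obtain ⟨δt, hδt, hδt'⟩ := exists_change_of_measure hα hL (hct.trans_lt ht₁)
  obtain ⟨δs, hδs, hδs'⟩ := exists_change_of_measure hα hL (hcs.trans_lt hs₁)
  have hexp : Tendsto (fun n : ℕ => Real.exp (n * (c₁ - lam))) atTop (𝓝 0) :=
    Real.tendsto_exp_atBot.comp
      (tendsto_natCast_atTop_atTop.atTop_mul_const_of_neg (sub_neg.2 hc₁))
  have htot : Tendsto (fun n : ℕ => δ n + ((Real.exp (n * (c₁ - lam)) + δt n)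
      + (Real.exp (n * (c₁ - lam)) + δs n))) atTop (𝓝 0) := by
    simpa using hδ.add ((hexp.add hδt).add (hexp.add hδs))
  -- Under `(Ω, Ψ)` the error terms are eventually below `1 / 2`; the remaining factor `1 / 2` costs
  -- `log 2 / n` in the exponent.
  have hbound : ∀ᶠ n : ℕ in atTop,
      optExponent K (L n) n lam P Q ≤ ((c + Real.log 2 / n : ℝ) : EReal) := by
    filter_upwards [eventually_gt_atTop 0,
      htot.eventually (gt_mem_nhds (by norm_num : (0 : ℝ) < 1 / 2))] with n hn hsmall
    refine optExponent_le hn (le_optFalseReject fun φ hφ => ?_)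
    have hn' : (n : ℝ) ≠ 0 := by positivity
    have h1 := one_le_prob_add hts φ Ω Ψ
    have h2 := hδ' n hn fun x y => φ x y = none
    have hmm : ∀ (u : Hyp M₁ M₂ K) (P' : Fin M₁ → stdSimplex ℝ X) (Q' : Fin M₂ → stdSimplex ℝ X),
        (∀ a ∈ u.1, P' a.1 = Q' a.2) →
        Real.exp (n * c₁) * prob P' Q' (fun x y => φ x y ≠ some u ∧ φ x y ≠ none)
          ≤ Real.exp (n * (c₁ - lam)) := by
      intro u P' Q' h
      rw [← mismatch_eq_prob, mul_sub, sub_eq_add_neg, Real.exp_add]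
      exact mul_le_mul_of_nonneg_left (hφ.mismatch_le u h) (Real.exp_pos _).le
    have h3 := hδt' n hn fun x y => φ x y ≠ some t ∧ φ x y ≠ none
    have h4 := hδs' n hn fun x y => φ x y ≠ some s ∧ φ x y ≠ none
    have h5 := hmm t Pt Qt hPQt
    have h6 := hmm s Ps Qs hPQs
    rw [← falseReject_eq_prob φ P Q] at h2
    have h7 : 1 / 2 ≤ Real.exp (n * c) * falseReject φ P Q := by linarith
    rw [mul_add, mul_div_cancel₀ _ hn', neg_add, Real.exp_add, Real.exp_neg (Real.log 2),
      Real.exp_log two_pos, Real.exp_neg]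
    rw [inv_mul_le_iff₀ (Real.exp_pos _)]
    linarith
  have hlim : Tendsto (fun n : ℕ => ((c + Real.log 2 / n : ℝ) : EReal)) atTop (𝓝 (c : EReal)) := by
    have h := (tendsto_const_div_atTop_nhds_zero_nat (Real.log 2)).const_add c
    rw [add_zero] at h
    exact (continuous_coe_real_ereal.tendsto c).comp h
  rw [← hlim.limsup_eq]
  exact limsup_le_limsup hbound

/-! ### Achievability bound -/

theorem tendsto_log_succ_div {α : ℝ} {L : ℕ → ℕ}
    (hL : Tendsto (fun n : ℕ => (L n : ℝ) / (n : ℝ)) atTop (𝓝 α)) :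
    Tendsto (fun n : ℕ => Real.log (L n + 1) / n) atTop (𝓝 0) := by
  have hlim : Tendsto (fun n : ℕ => 2 * Real.sqrt (((L n : ℝ) / n + 1 / n) * (1 / n))) atTop
      (𝓝 0) := by
    have h1 := tendsto_const_div_atTop_nhds_zero_nat (1 : ℝ)
    have h2 := (((hL.add h1).mul h1).sqrt).const_mul 2
    simpa using h2
  refine tendsto_of_tendsto_of_tendsto_of_le_of_le' tendsto_const_nhds hlim
    (Eventually.of_forall fun n => ?_) ?_
  · exact div_nonneg (Real.log_nonneg (by simp)) (Nat.cast_nonneg n)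
  · filter_upwards [eventually_gt_atTop 0] with n hn
    have hpos : (0 : ℝ) < L n + 1 := by positivity
    have h1 : Real.log (L n + 1) ≤ 2 * Real.sqrt (L n + 1) := by
      have h2 := Real.log_le_self (Real.sqrt_nonneg ((L n : ℝ) + 1))
      rw [Real.log_sqrt hpos.le] at h2
      linarith
    have h3 : ((L n : ℝ) / n + 1 / n) * (1 / n) = (L n + 1) / (n : ℝ) ^ 2 := by
      field_simp
    rw [h3, Real.sqrt_div hpos.le, Real.sqrt_sq (Nat.cast_nonneg n), ← mul_div_assoc]
    gcongr

theorem tendsto_log_typeBound_div (X : Type*) [Fintype X] (M₁ M₂ : ℕ) {α : ℝ} {L : ℕ → ℕ}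
    (hL : Tendsto (fun n : ℕ => (L n : ℝ) / (n : ℝ)) atTop (𝓝 α)) :
    Tendsto (fun n : ℕ => Real.log (typeBound X M₁ M₂ (L n) n) / n) atTop (𝓝 0) := by
  have hid : Tendsto (fun n : ℕ => (n : ℝ) / (n : ℝ)) atTop (𝓝 1) :=
    tendsto_const_nhds.congr' ((eventually_gt_atTop 0).mono fun n hn =>
      (div_self (by positivity : (n : ℝ) ≠ 0)).symm)
  have h := ((tendsto_log_succ_div hL).const_mul ((M₁ : ℝ) * Fintype.card X)).add
    ((tendsto_log_succ_div (L := id) hid).const_mul ((M₂ : ℝ) * Fintype.card X))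
  rw [mul_zero, mul_zero, add_zero] at h
  refine h.congr fun n => ?_
  have h1 : ((L n : ℝ) + 1) ≠ 0 := by positivity
  have h2 : ((n : ℝ) + 1) ≠ 0 := by positivity
  rw [typeBound]
  push_cast
  rw [Real.log_mul (by positivity) (by positivity), Real.log_pow, Real.log_pow, Real.log_pow,
    Real.log_pow]
  simp only [id]
  ring

/-- A universal test that rejects only if the scores of two hypotheses are below a threshold
slightly larger than `lam`. -/
theorem exists_universal_test (hN : 0 < N) (hn : 0 < n) (l : Hyp M₁ M₂ K) (X : Type*) [Fintype X]
    (lam : ℝ) :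
    ∃ φ : Test X M₁ M₂ K N n, Universal φ lam ∧ ∀ x y, φ x y = none →
      ∃ t s : Hyp M₁ M₂ K, t ≠ s ∧ ∀ u, u = t ∨ u = s →
        score u (fun i => empirical hN (x i)) (fun j => empirical hn (y j)) ((N : ℝ) / n)
          ≤ ENNReal.ofReal (lam + Real.log (typeBound X M₁ M₂ N n) / n) := by
  classical
  set thr := lam + Real.log (typeBound X M₁ M₂ N n) / n with hthr
  set low : Hyp M₁ M₂ K → (Fin M₁ → Fin N → X) → (Fin M₂ → Fin n → X) → Prop := fun u x y =>
    score u (fun i => empirical hN (x i)) (fun j => empirical hn (y j)) ((N : ℝ) / n)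
      ≤ ENNReal.ofReal thr with hlow
  -- With exactly one low score the test picks that hypothesis; with none, the choice `l` is
  -- arbitrary. A mismatch under `s` thus forces the score of `s` above the threshold.
  set φ : Test X M₁ M₂ K N n := fun x y =>
    if ∃ t s, t ≠ s ∧ ∀ u, u = t ∨ u = s → low u x y then none
    else if h : ∃ t, low t x y then some h.choose else some l with hφ
  refine ⟨φ, fun s PQ hPQ => ?_, fun x y h => ?_⟩
  · have hmis : ∀ x y, φ x y ≠ some s ∧ φ x y ≠ none → ¬ low s x y := by
      rintro x y ⟨h1, h2⟩ hs
      simp only [hφ] at h1 h2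
      split_ifs at h1 h2 with h3 h4
      · exact h2 rfl
      · refine h3 ⟨h4.choose, s, fun h => h1 (by rw [h]), ?_⟩
        rintro u (rfl | rfl)
        exacts [h4.choose_spec, hs]
      · exact h4 ⟨s, hs⟩
    rw [mismatch_eq_prob]
    refine (prob_le_of_le_cost hN hn PQ.1 PQ.2 _ (c := thr) fun x y h => ?_).trans (le_of_eq ?_)
    · exact (not_le.1 (hmis x y h)).le.trans
        (score_le_cost (by positivity) s (fun a ha => (hPQ a.1 a.2).2 ha) _ _)
    -- The term `log (typeBound ..) / n` in the threshold exactly cancels the number of types.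
    · have hn' : (n : ℝ) ≠ 0 := by positivity
      have hB : (0 : ℝ) < typeBound X M₁ M₂ N n := Nat.cast_pos.2 (typeBound_pos X M₁ M₂ N n)
      rw [hthr, mul_add, mul_div_cancel₀ _ hn', neg_add, Real.exp_add,
        Real.exp_neg (Real.log _), Real.exp_log hB, mul_left_comm, mul_inv_cancel₀ hB.ne', mul_one]
  · simp only [hφ] at h
    split_ifs at h with h3
    exact h3

/-- A rejection puts the empirical tuple in the feasible set for the parameters `N / n` and the
threshold, so its cost is at least `expF` there, which is eventually at least any `c` below the
limiting value. -/
theorem expF_le_liminf_optExponent {α : ℝ} (hα : 0 < α) {L : ℕ → ℕ}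
    (hL : Tendsto (fun n : ℕ => (L n : ℝ) / (n : ℝ)) atTop (𝓝 α)) {l : Hyp M₁ M₂ K}
    {P : Fin M₁ → stdSimplex ℝ X} {Q : Fin M₂ → stdSimplex ℝ X}
    (hPQ : ∀ a ∈ l.1, P a.1 = Q a.2) (lam : ℝ) :
    ((expF l P Q α lam : ℝ≥0∞) : EReal)
      ≤ liminf (fun n : ℕ => optExponent K (L n) n lam P Q) atTop := by
  refine le_of_forall_lt fun d hd => ?_
  obtain ⟨c, hc1, hc2⟩ := EReal.lt_iff_exists_real_btwn.1 hd
  refine lt_of_lt_of_le hc1 ?_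
  have hev : ∀ᶠ z : ℝ × ℝ in 𝓝 (α, lam), ENNReal.ofReal c ≤ expF l P Q z.1 z.2 := by
    -- For `c ≤ 0` the truncation `ENNReal.ofReal c` is zero and nothing has to be shown.
    rcases le_or_gt c 0 with h0 | h0
    · simp [ENNReal.ofReal_of_nonpos h0]
    · refine eventually_lt_expF hPQ hα ?_
      rw [← EReal.coe_ennreal_lt_coe_ennreal_iff, EReal.coe_ennreal_ofReal, max_eq_left h0.le]
      exact hc2
  have hB := tendsto_log_typeBound_div X M₁ M₂ hL
  have hthr : Tendsto (fun n : ℕ => lam + Real.log (typeBound X M₁ M₂ (L n) n) / n) atTop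
      (𝓝 lam) := by
    simpa using hB.const_add lam
  have hbound : ∀ᶠ n : ℕ in atTop,
      ((c - Real.log (typeBound X M₁ M₂ (L n) n) / n : ℝ) : EReal)
        ≤ optExponent K (L n) n lam P Q := by
    filter_upwards [eventually_gt_atTop 0, hL.eventually (lt_mem_nhds hα),
      (hL.prodMk_nhds hthr).eventually hev] with n hn hLn hF
    have hLpos : 0 < L n := by
      rcases Nat.eq_zero_or_pos (L n) with h | h
      · simp [h] at hLn
      · exact h
    obtain ⟨φ, hφ, hrej⟩ := exists_universal_test hLpos hn l X lam
    refine le_optExponent hn ((optFalseReject_le hφ P Q).trans ?_)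
    rw [falseReject_eq_prob]
    refine (prob_le_of_le_cost hLpos hn P Q _ (c := c) fun x y h => ?_).trans (le_of_eq ?_)
    · obtain ⟨t, s, hts, hu⟩ := hrej x y h
      rw [← expE_eq_cost l hPQ]
      exact le_expF_iff.1 hF t s hts _ _ (hu t (Or.inl rfl)) (hu s (Or.inr rfl))
    · have hn' : (n : ℝ) ≠ 0 := by positivity
      have hB : (0 : ℝ) < typeBound X M₁ M₂ (L n) n :=
        Nat.cast_pos.2 (typeBound_pos X M₁ M₂ (L n) n)
      rw [mul_sub, mul_div_cancel₀ _ hn', neg_sub, sub_eq_add_neg, Real.exp_add, Real.exp_log hB]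
  have hlim : Tendsto (fun n : ℕ => ((c - Real.log (typeBound X M₁ M₂ (L n) n) / n : ℝ) : EReal))
      atTop (𝓝 (c : EReal)) := by
    have h := hB.const_sub c
    rw [sub_zero] at h
    exact (continuous_coe_real_ereal.tendsto c).comp h
  rw [← hlim.liminf_eq]
  exact liminf_le_liminf hbound

theorem tendsto_optExponent {α : ℝ} (hα : 0 < α) {L : ℕ → ℕ}
    (hL : Tendsto (fun n : ℕ => (L n : ℝ) / (n : ℝ)) atTop (𝓝 α)) {l : Hyp M₁ M₂ K}
    {P : Fin M₁ → stdSimplex ℝ X} {Q : Fin M₂ → stdSimplex ℝ X} (hPQ : (P, Q) ∈ genDist X l)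
    {lam : ℝ} (h : strictExpF l P Q α lam ≤ expF l P Q α lam) :
    Tendsto (fun n : ℕ => optExponent K (L n) n lam P Q) atTop
      (𝓝 ((expF l P Q α lam : ℝ≥0∞) : EReal)) :=
  tendsto_of_le_liminf_of_limsup_le
    (expF_le_liminf_optExponent hα hL (fun a ha => (hPQ a.1 a.2).2 ha) lam)
    ((limsup_optExponent_le_strictExpF hα hL hPQ lam).trans
      (EReal.coe_ennreal_le_coe_ennreal_iff.2 h))

end

end SeqMatch

end

theorem theorem2 {X : Type*} [Fintype X] (M₁ M₂ K : ℕ)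
    (hK : 1 ≤ K) (hK₂ : K ≤ M₂) (hM : M₂ ≤ M₁)
    (α : ℝ) (hα : 0 < α)
    (N : ℕ → ℕ) (hN : Tendsto (fun n : ℕ => (N n : ℝ) / (n : ℝ)) atTop (𝓝 α))
    (l : SeqMatch.Hyp M₁ M₂ K)
    (P : Fin M₁ → stdSimplex ℝ X) (Q : Fin M₂ → stdSimplex ℝ X)
    (hPQ : (P, Q) ∈ SeqMatch.genDist X l) :
    ((∃ x : X, (∀ i, 0 < P i x) ∧ (∀ j, 0 < Q j x)) →
      ∀ lam : ℝ, 0 < lam →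
        Tendsto (fun n : ℕ => SeqMatch.optExponent K (N n) n lam P Q) atTop
          (𝓝 ((SeqMatch.expF l P Q α lam : ℝ≥0∞) : EReal))) ∧
    (∀ lam : ℝ, 0 < lam → ContinuousAt (fun r : ℝ => SeqMatch.expF l P Q α r) lam →
        Tendsto (fun n : ℕ => SeqMatch.optExponent K (N n) n lam P Q) atTop
          (𝓝 ((SeqMatch.expF l P Q α lam : ℝ≥0∞) : EReal))) ∧
    {lam : ℝ | 0 < lam ∧
      ¬ ContinuousAt (fun r : ℝ => SeqMatch.expF l P Q α r) lam}.Finite ∧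
    (∀ lam : ℝ, 0 ≤ lam →
      ((SeqMatch.expF l P Q α lam : ℝ≥0∞) : EReal) ≤
        liminf (fun n : ℕ => SeqMatch.optExponent K (N n) n lam P Q) atTop) := by
  have hPQ' : ∀ a ∈ l.1, P a.1 = Q a.2 := fun a ha => (hPQ a.1 a.2).2 ha
  refine ⟨fun hx lam hlam => ?_, fun lam hlam hc => ?_, ?_, fun lam _ => ?_⟩
  · exact SeqMatch.tendsto_optExponent hα hN hPQ
      (SeqMatch.strictExpF_le_of_common_support hPQ' hα hlam hx)
  · exact SeqMatch.tendsto_optExponent hα hN hPQ (SeqMatch.strictExpF_le_of_continuousAt hlam hc)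
  · exact SeqMatch.finite_discontinuities hPQ' hα
  · exact SeqMatch.expF_le_liminf_optExponent hα hN hPQ' lam
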